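/- **Theorem 4.3 (second-order verification of Robinson stability).** *Notation.* All spaces are Euclidean. Let $\Omega\subset\mathbb R^s$ and $\bar z\in\Omega$. The contingent cone $T_\Omega(\bar z)$ consists of all $u$ for which there are $t_k\downarrow0$ and $u_k\to u$ with $\bar z+t_ku_k\in\Omega$ for all $k$. The regular normal cone is $\widehat N_\Omega(\bar z)=\{v\mid\langle v,u\rangle\le0\ \text{for all }u\in T_\Omega(\bar z)\}$. The limiting normal cone $N_\Omega(\bar z)$ consists of all limits $v=\lim v_k$ with $v_k\in\widehat N_\Omega(z_k)$, $z_k\in\Omega$, $z_k\to\bar z$, and $N_\Omega(z)=\emptyset$ for $z\notin\Omega$. The limiting normal cone $N_\Omega(\bar z;w)$ in direction $w$ consists of all limits $v=\lim v_k$ with $v_k\in\widehat N_\Omega(\bar z+t_kw_k)$, $\bar z+t_kw_k\in\Omega$, for some $t_k\downarrow0$, $w_k\to w$. For $v\in T_\Omega(\bar z)$ and $\lambda\in\mathbb R^s$ the upper and lower curvatures are $$\overline\chi_\Omega(\lambda,\bar z;v)=\lim_{\varepsilon\downarrow0}\sup\Big\{\tfrac{\langle\lambda,v'-v\rangle}{\tau}\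 \Big|\ 0<\tau<\varepsilon,\ \|v'-v\|<\varepsilon,\ \bar z+\tau v'\in\Omega\Big\},$$ $$\underline\chi_\Omega(\lambda,\bar z;v)=\lim_{\varepsilon\downarrow0}\inf\Big\{\tfrac{\langle\lambda,v'-v\rangle}{\tau}\ \Big|\ 0<\tau<\varepsilon,\ \|v'-v\|<\varepsilon,\ \operatorname{dist}(\lambda;N_\Omega(\bar z+\tau v'))<\varepsilon\Big\},$$ with values in $[-\infty,\infty]$, where $\sup\emptyset=-\infty$, $\inf\emptyset=+\infty$ and $\operatorname{dist}(\cdot;\emptyset)=\infty$. A system $g(p,x)\in C$, $p\in P$, is *Robinson stable* at $(\bar p,\bar x)$ if there are $\kappa\ge0$ and neighborhoods $U$ of $\bar x$ and $V$ of $\bar p$ in $P$ such that $\operatorname{dist}(x;\Gamma(p))\le\kappa\operatorname{dist}(g(p,x);C)$ for all $(p,x)\in V\times U$, where $\Gamma(p)=\{x\mid g(p,x)\in C\}$. *Setting.* Let $P\subset\mathbb R^m$, $g=(g_1,g_2):\mathbb R^m\times\mathbb R^n\to\mathbb R^{l_1}\times\mathbb R^{l_2}=\mathbb R^l$, $C=C_1\times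 C_2$ with $C_i\subset\mathbb R^{l_i}$, and let $\bar p\in P$, $\bar x\in\mathbb R^n$ satisfy $\bar g:=g(\bar p,\bar x)\in C$. Let $C_i$ be locally closed around $g_i(\bar p,\bar x)$, $i=1,2$. Assume that for all $p\in P$ near $\bar p$ the mapping $g(p,\cdot)$ is continuously differentiable on a common neighborhood of $\bar x$, that $g$ and $\nabla_xg$ are continuous at $(\bar p,\bar x)$ relative to $P\times\mathbb R^n$, and that $g$ is twice differentiable at $(\bar p,\bar x)$ (differentiable near this point, with a derivative that is differentiable at it). Write $\nabla\bar g=\nabla g(\bar p,\bar x)$. *Assumptions.* 1. For every $w\in T_P(\bar p)$ and every sequence $\tau_k\downarrow0$ there is $u\in\mathbb R^n$ with $\liminf_{k\to\infty}\operatorname{dist}\big(\bar g+\tau_k\nabla\bar g(w,u);C\big)/\tau_k=0$. 2. The subsystem $g_2(p,x)\in C_2$, $p\in P$, is Robinson stable at $(\bar p,\bar x)$. 3. Every triple $(w,u,\lambda)\in\mathbb R^m\times\mathbb R^n\times\mathbb R^l$, $\lambda=(\lambda^1,\lambda^2)\in\mathbb R^{l_1}\times\mathbb R^{l_2}$, with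 $$(w,u)\ne(0,0),\quad w\in T_P(\bar p),\quad \nabla\bar g(w,u)\in T_C(\bar g),$$ $$\lambda\in N_C\big(\bar g;\nabla\bar g(w,u)\big),\quad \nabla_xg(\bar p,\bar x)^*\lambda=0,$$ $$\tfrac12\big\langle\nabla^2\langle\lambda,g\rangle(\bar p,\bar x)(w,u),(w,u)\big\rangle+\overline\chi_P\big(\nabla_pg(\bar p,\bar x)^*\lambda,\bar p;w\big)\ \ge\ \underline\chi_C\big(\lambda,\bar g;\nabla\bar g(w,u)\big)$$ satisfies $\lambda^1=0$. *Conclusion.* The whole system $g(p,x)\in C$, $p\in P$, is Robinson stable at $(\bar p,\bar x)$. -/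

import Mathlib

open Filter Topology Set

noncomputable section

section Cones

variable {E : Type*} [NormedAddCommGroup E] [InnerProductSpace ℝ E]

/-- `Ω` is locally closed around the point `z`. -/
def LocallyClosedAround (Ω : Set E) (z : E) : Prop :=
  ∃ r : ℝ, 0 < r ∧ IsClosed (Ω ∩ Metric.closedBall z r)

/-- The (Bouligand-Severi) contingent cone `T_Ω(z)`. -/
def contingentCone (Ω : Set E) (z : E) : Set E :=
  {u | ∃ (t : ℕ → ℝ) (u' : ℕ → E), (∀ k, 0 < t k) ∧ Tendsto t atTop (𝓝 0) ∧
    Tendsto u' atTop (𝓝 u) ∧ ∀ k, z + t k • u' k ∈ Ω}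

/-- The (Fréchet) regular normal cone to `Ω` at `z`, the polar of the contingent cone. -/
def regularNormalCone (Ω : Set E) (z : E) : Set E :=
  {v | ∀ u ∈ contingentCone Ω z, inner ℝ v u ≤ 0}

/-- The (Mordukhovich) limiting normal cone `N_Ω(z)`; it is empty for `z ∉ Ω`. -/
def limitingNormalCone (Ω : Set E) (z : E) : Set E :=
  {v | z ∈ Ω ∧ ∃ (z' v' : ℕ → E), Tendsto z' atTop (𝓝 z) ∧ Tendsto v' atTop (𝓝 v) ∧
    ∀ k, z' k ∈ Ω ∧ v' k ∈ regularNormalCone Ω (z' k)}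

/-- The limiting normal cone `N_Ω(z; w)` in direction `w`. -/
def directionalNormalCone (Ω : Set E) (z w : E) : Set E :=
  {v | ∃ (t : ℕ → ℝ) (w' v' : ℕ → E), (∀ k, 0 < t k) ∧ Tendsto t atTop (𝓝 0) ∧
    Tendsto w' atTop (𝓝 w) ∧ Tendsto v' atTop (𝓝 v) ∧
    ∀ k, z + t k • w' k ∈ Ω ∧ v' k ∈ regularNormalCone Ω (z + t k • w' k)}

/-- The upper curvature of `Ω` at `z` in direction `v` for the multiplier `lam`, as an extended
real number. The supremum (`⊥` over the empty set) decreases as `ε ↓ 0`, so that its limit is the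
infimum over all `ε > 0`. -/
def upperCurvature (Ω : Set E) (lam z v : E) : EReal :=
  ⨅ ε : {ε : ℝ // 0 < ε}, sSup {r : EReal | ∃ (τ : ℝ) (v' : E), 0 < τ ∧ τ < ε ∧
    ‖v' - v‖ < ε ∧ z + τ • v' ∈ Ω ∧ r = ((inner ℝ lam (v' - v) / τ : ℝ) : EReal)}

/-- The lower curvature of `Ω` at `z` in direction `v` for the multiplier `lam`, as an extended
real number. The infimum (`⊤` over the empty set) increases as `ε ↓ 0`, so that its limit is the
supremum over all `ε > 0`. The distance to an empty normal cone is infinite. -/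
def lowerCurvature (Ω : Set E) (lam z v : E) : EReal :=
  ⨆ ε : {ε : ℝ // 0 < ε}, sInf {r : EReal | ∃ (τ : ℝ) (v' : E), 0 < τ ∧ τ < ε ∧
    ‖v' - v‖ < ε ∧ Metric.infEDist lam (limitingNormalCone Ω (z + τ • v')) < ENNReal.ofReal ε ∧
    r = ((inner ℝ lam (v' - v) / τ : ℝ) : EReal)}

end Cones

section Systems

variable {E F G : Type*} [NormedAddCommGroup E] [NormedSpace ℝ E]
  [NormedAddCommGroup F] [NormedSpace ℝ F] [NormedAddCommGroup G] [NormedSpace ℝ G]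

/-- `f` is twice differentiable at `z`: it is differentiable near `z`, and its derivative is
differentiable at `z`. -/
def TwiceDifferentiableAt (f : E → G) (z : E) : Prop :=
  (∀ᶠ z' in 𝓝 z, DifferentiableAt ℝ f z') ∧ DifferentiableAt ℝ (fderiv ℝ f) z

/-- Smoothness of `g` in the decision variable, with parameters restricted to `P`: there are
neighborhoods `U` of `x₀` and `V` of `p₀` such that `g (p, ·)` is continuously differentiable
on `U` for each `p ∈ P ∩ V`, and both `g` and its partial derivative in `x` are continuous at
`(p₀, x₀)` relative to `P × F`. -/
def SmoothInDecision (P : Set E) (g : E × F → G) (p₀ : E) (x₀ : F) : Prop :=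
  (∃ U ∈ 𝓝 x₀, ∃ V ∈ 𝓝 p₀, ∀ p ∈ P ∩ V, ∀ x ∈ U, ContDiffAt ℝ 1 (fun y => g (p, y)) x) ∧
  ContinuousWithinAt g (P ×ˢ univ) (p₀, x₀) ∧
  ContinuousWithinAt (fun z : E × F => fderiv ℝ (fun y => g (z.1, y)) z.2) (P ×ˢ univ) (p₀, x₀)

/-- The solution set `Γ(p) = {x | g(p, x) ∈ C}`. -/
def solutionSet (g : E × F → G) (C : Set G) (p : E) : Set F :=
  {x | g (p, x) ∈ C}

/-- Robinson stability of `g(p, x) ∈ C`, `p ∈ P`, at `(p₀, x₀)`, with some modulus `κ ≥ 0`.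
Distances are extended: the distance to the empty set is `∞`. -/
def RobinsonStable (P : Set E) (g : E × F → G) (C : Set G) (p₀ : E) (x₀ : F) : Prop :=
  ∃ κ : NNReal, ∃ U ∈ 𝓝 x₀, ∃ V ∈ 𝓝 p₀, ∀ p ∈ P ∩ V, ∀ x ∈ U,
    Metric.infEDist x (solutionSet g C p) ≤ κ * Metric.infEDist (g (p, x)) C

end Systems

/-- The Euclidean space `ℝ^{l₁} × ℝ^{l₂} = ℝ^{l₁ + l₂}`. -/
abbrev SplitSpace (l₁ l₂ : ℕ) : Type :=
  WithLp 2 (EuclideanSpace ℝ (Fin l₁) × EuclideanSpace ℝ (Fin l₂))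

/-- The product set `C₁ × C₂` in `ℝ^{l₁} × ℝ^{l₂}`. -/
def splitSet {l₁ l₂ : ℕ} (C₁ : Set (EuclideanSpace ℝ (Fin l₁)))
    (C₂ : Set (EuclideanSpace ℝ (Fin l₂))) : Set (SplitSpace l₁ l₂) :=
  {c | c.fst ∈ C₁ ∧ c.snd ∈ C₂}

end

/-! Argue by contradiction. If Robinson stability fails, then arbitrarily near the reference pair
there are `(p, x)` whose distance to `Γ(p)` exceeds any prescribed multiple of the residual `D`.
Stability of the second subsystem moves `x` by `O(D)` to a point feasible for it. Minimizing
`dist(g₁(p, ·); C₁)` plus a small multiple `σ` of the displacement, over `g₂(p, ·) ∈ C₂`, again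
moves the point by only `O(D)`, so the minimizer still violates the first constraint. Its projection
residual, of length `a > 0`, gives a unit multiplier `λ¹`. Stability of the second subsystem acts as
a constraint qualification: it makes an exact penalty available and bounds `λ²` uniformly
(`exists_approximate_multiplier`). The result is a sequence of approximate KKT points with `‖λ¹‖ =
1` (`exists_approximate_kkt_of_not_robinsonStable`).

Scale by the distance `t` to the reference pair and pass to limits `(w, u) ≠ 0` and `λ`. Tangential
solvability supplies competitors with residual `o(t)`, so minimality forces `a = o(t)`
(`tendsto_residual_div`). Hence the projected values reach `C` in direction `∇g(w, u)`, and `λ` is a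
directional normal there.

An error `o(t)` would be too coarse for second-order information, but its sign is favorable: the
first component of `c - g(p, x)` is `-a λ¹`, so pairing it with the limit multiplier is eventually
nonpositive and it can be dropped. The second component is `o(t²)` by construction. A Taylor
expansion of `⟨λ, g⟩` and stationarity in `x` then give the curvature inequality
(`curvature_le_of_approximate_kkt`). The second-order condition yields `λ¹ = 0`, contradicting `‖λ¹‖
= 1`. -/

/-! ### Nearest points, proximal normals and a Fermat rule. -/

/-- Expanding `‖y - c‖² ≤ ‖y - c - t u'‖²` and dividing by `t` leaves `2⟨y - c, u'⟩ ≤ t‖u'‖²`, whose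
right side vanishes in the limit. -/
theorem smul_sub_mem_regularNormalCone {E : Type*} [NormedAddCommGroup E] [InnerProductSpace ℝ E]
    {Ω : Set E} {y c : E} (hmin : ∀ᶠ c' in 𝓝 c, c' ∈ Ω → ‖y - c‖ ≤ ‖y - c'‖)
    {a : ℝ} (ha : 0 ≤ a) : a • (y - c) ∈ regularNormalCone Ω c := by
  rintro u ⟨t, u', htpos, ht, hu, hmem⟩
  have hlim : Tendsto (fun k => c + t k • u' k) atTop (𝓝 c) := by
    simpa using (ht.smul hu).const_add c
  have key : ∀ᶠ k in atTop, 2 * inner ℝ (y - c) (u' k) ≤ t k * ‖u' k‖ ^ 2 := by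
    filter_upwards [hlim.eventually hmin] with k hk
    have h1 := hk (hmem k)
    have h2 : ‖y - c‖ ^ 2 ≤ ‖y - (c + t k • u' k)‖ ^ 2 := by gcongr
    rw [← sub_sub, norm_sub_sq_real (y - c), inner_smul_right, norm_smul, Real.norm_eq_abs,
      abs_of_pos (htpos k)] at h2
    have := htpos k
    have h3 : 0 ≤ t k * (t k * ‖u' k‖ ^ 2 - 2 * inner ℝ (y - c) (u' k)) := by linarith
    have := nonneg_of_mul_nonneg_right h3 this
    linarith
  have hl : Tendsto (fun k => 2 * inner ℝ (y - c) (u' k)) atTop (𝓝 (2 * inner ℝ (y - c) u)) :=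
    (tendsto_const_nhds.inner hu).const_mul 2
  have hr : Tendsto (fun k => t k * ‖u' k‖ ^ 2) atTop (𝓝 0) := by
    simpa using ht.mul (hu.norm.pow 2)
  have := le_of_tendsto_of_tendsto hl hr key
  rw [real_inner_smul_left]
  exact mul_nonpos_of_nonneg_of_nonpos ha (by linarith)

/-- Local closedness suffices: a point outside the ball of radius `R` is farther than `R / 2` from
`y`, so it cannot beat `z`. -/
theorem exists_nearest_point {E : Type*} [NormedAddCommGroup E] [ProperSpace E]
    {C : Set E} {z y : E} {R : ℝ} (hz : z ∈ C) (hC : IsClosed (C ∩ Metric.closedBall z R))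
    (hy : ‖y - z‖ < R / 2) :
    ∃ c ∈ C, ‖y - c‖ = Metric.infDist y C ∧ ∀ c' ∈ C, ‖y - c‖ ≤ ‖y - c'‖ := by
  have hR : 0 < R := by linarith [norm_nonneg (y - z)]
  have hcomp : IsCompact (C ∩ Metric.closedBall z R) :=
    (isCompact_closedBall z R).of_isClosed_subset hC inter_subset_right
  obtain ⟨c, hc, hmin⟩ := hcomp.exists_isMinOn ⟨z, hz, Metric.mem_closedBall_self hR.le⟩
    (f := fun c => ‖y - c‖) (by fun_prop)
  have hmin' : ∀ c' ∈ C, ‖y - c‖ ≤ ‖y - c'‖ := by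
    intro c' hc'
    by_cases h : c' ∈ Metric.closedBall z R
    · exact hmin ⟨hc', h⟩
    · have h1 : ‖y - c‖ ≤ ‖y - z‖ := hmin ⟨hz, Metric.mem_closedBall_self hR.le⟩
      rw [mem_closedBall_iff_norm, not_le] at h
      have h2 : ‖c' - z‖ ≤ ‖y - z‖ + ‖y - c'‖ := by
        calc ‖c' - z‖ = ‖(y - z) - (y - c')‖ := by congr 1; abel
          _ ≤ _ := norm_sub_le _ _
      linarith
  refine ⟨c, hc.1, le_antisymm ?_ ?_, hmin'⟩
  · exact (Metric.le_infDist ⟨c, hc.1⟩).2 fun {c'} hc' => by rw [dist_eq_norm]; exact hmin' c' hc'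
  · rw [← dist_eq_norm]; exact Metric.infDist_le_dist_of_mem hc.1

/-- Fermat's rule with a nonsmooth term: the slope of `s` in direction `v` is at least `-a‖v‖`, and
the same for `-v`. -/
theorem norm_fderiv_le_of_eventually_le {E : Type*} [NormedAddCommGroup E] [NormedSpace ℝ E]
    {s : E → ℝ} {s' : E →L[ℝ] ℝ} {x : E} {a : ℝ} (ha : 0 ≤ a) (hs : HasFDerivAt s s' x)
    (hmin : ∀ᶠ y in 𝓝 x, s x ≤ s y + a * ‖y - x‖) : ‖s'‖ ≤ a := by
  have key : ∀ v, -(s' v) ≤ a * ‖v‖ := by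
    intro v
    have hline : HasDerivAt (fun t : ℝ => s (x + t • v)) (s' v) 0 := by
      have h1 : HasDerivAt (fun t : ℝ => x + t • v) v 0 := by
        simpa using ((hasDerivAt_id (0 : ℝ)).smul_const v).const_add x
      have h2 : HasFDerivAt s s' (x + (0 : ℝ) • v) := by simpa using hs
      exact h2.comp_hasDerivAt (0 : ℝ) h1
    have hlim := hline.tendsto_slope_zero_right
    simp only [zero_add, zero_smul, add_zero] at hlim
    have hcont : Tendsto (fun t : ℝ => x + t • v) (𝓝[>] 0) (𝓝 x) := by
      have : Tendsto (fun t : ℝ => x + t • v) (𝓝 0) (𝓝 (x + (0 : ℝ) • v)) :=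
        Continuous.tendsto (by fun_prop) 0
      simpa using this.mono_left nhdsWithin_le_nhds
    have hev : ∀ᶠ t in 𝓝[>] (0 : ℝ), -(a * ‖v‖) ≤ t⁻¹ • (s (x + t • v) - s x) := by
      filter_upwards [hcont.eventually hmin, self_mem_nhdsWithin] with t ht htpos
      have htpos : 0 < t := htpos
      rw [add_sub_cancel_left, norm_smul, Real.norm_eq_abs, abs_of_pos htpos] at ht
      rw [smul_eq_mul, inv_mul_eq_div, le_div_iff₀ htpos]
      linarith
    linarith [ge_of_tendsto hlim hev]
  refine s'.opNorm_le_bound ha fun v => ?_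
  rw [Real.norm_eq_abs, abs_le]
  constructor
  · linarith [key v]
  · have := key (-v)
    rw [map_neg, norm_neg] at this
    linarith

/-! ### Exact penalization and multipliers under calmness. -/

/-- Calmness of the constraint `h₂ x ∈ C₂` makes a constrained local minimizer a minimizer of the
exactly penalized function. -/
theorem exact_penalty {X G₁ G₂ : Type*} [NormedAddCommGroup X] [NormedAddCommGroup G₁]
    [NormedAddCommGroup G₂] {h₁ : X → G₁} {h₂ : X → G₂} {C₂ : Set G₂} {x₀ : X} {c₁ : G₁}
    {r κ σ : ℝ} {L : NNReal} (hr : 0 < r) (hσ : 0 < σ) (hx₀ : h₂ x₀ ∈ C₂)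
    (hcalm : ∀ x ∈ Metric.closedBall x₀ r, ∀ c ∈ C₂,
      Metric.infDist x {x | h₂ x ∈ C₂} ≤ κ * ‖h₂ x - c‖)
    (hmin : ∀ x ∈ Metric.ball x₀ (3 * r), h₂ x ∈ C₂ →
      ‖h₁ x₀ - c₁‖ ≤ ‖h₁ x - c₁‖ + σ * ‖x - x₀‖)
    (hLip : LipschitzOnWith L h₁ (Metric.ball x₀ (3 * r)))
    {x : X} (hx : x ∈ Metric.closedBall x₀ r) {c : G₂} (hc : c ∈ C₂) :
    ‖h₁ x₀ - c₁‖ ≤ ‖h₁ x - c₁‖ + σ * ‖x - x₀‖ + (L + σ) * κ * ‖h₂ x - c‖ := by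
  have hLσ : 0 < (L : ℝ) + σ := by positivity
  refine le_of_forall_pos_le_add fun η hη => ?_
  -- The slack `δ` replaces an attained projection. Since `infDist ≤ r`, the near-projection `x'`
  -- stays within `r + r + δ ≤ 3 * r` of `x₀`, and the slack costs at most `η`.
  set δ := min r (η / (L + σ)) with hδ
  have hδpos : 0 < δ := lt_min hr (by positivity)
  have hne : {x | h₂ x ∈ C₂}.Nonempty := ⟨x₀, hx₀⟩
  obtain ⟨x', hx', hxx'⟩ := (Metric.infDist_lt_iff hne).1
    (lt_add_of_pos_right (Metric.infDist x {x | h₂ x ∈ C₂}) hδpos)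
  have hd1 := hcalm x hx c hc
  have hd2 : Metric.infDist x {x | h₂ x ∈ C₂} ≤ dist x x₀ := Metric.infDist_le_dist_of_mem hx₀
  have hxr : dist x x₀ ≤ r := hx
  have hδr : δ ≤ r := min_le_left _ _
  have hδη : (L + σ) * δ ≤ η := by
    have := min_le_right r (η / (L + σ))
    rw [le_div_iff₀ hLσ] at this
    linarith
  have hx'b : x' ∈ Metric.ball x₀ (3 * r) := by
    rw [Metric.mem_ball]
    linarith [dist_triangle_left x' x₀ x]
  have hxb : x ∈ Metric.ball x₀ (3 * r) := by
    rw [Metric.mem_ball]; linarith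
  have h1 := hmin x' hx'b hx'
  have h2 : ‖h₁ x' - c₁‖ ≤ ‖h₁ x - c₁‖ + L * dist x x' := by
    have h3 := hLip.dist_le_mul x' hx'b x hxb
    rw [dist_eq_norm, dist_comm x' x] at h3
    calc ‖h₁ x' - c₁‖ = ‖(h₁ x - c₁) + (h₁ x' - h₁ x)‖ := by congr 1; abel
      _ ≤ _ := (norm_add_le _ _).trans (by linarith)
  have h3 : ‖x' - x₀‖ ≤ ‖x - x₀‖ + dist x x' := by
    rw [← dist_eq_norm, ← dist_eq_norm]; linarith [dist_triangle_left x' x₀ x]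
  have h4 : (L + σ) * dist x x' ≤ (L + σ) * (κ * ‖h₂ x - c‖ + δ) := by
    gcongr; linarith
  have h5 := mul_le_mul_of_nonneg_left h3 hσ.le
  nlinarith

/-- Approximate multiplier rule for minimizing `‖h₁ x - c₁‖ + σ * ‖x - x₀‖` subject to the calm
constraint `h₂ x ∈ C₂`. -/
theorem exists_approximate_multiplier {X G₁ G₂ : Type*} [NormedAddCommGroup X] [NormedSpace ℝ X]
    [ProperSpace X]
    [NormedAddCommGroup G₁] [InnerProductSpace ℝ G₁]
    [NormedAddCommGroup G₂] [InnerProductSpace ℝ G₂] [ProperSpace G₂]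
    {h₁ : X → G₁} {h₂ : X → G₂} {h₁' : X → X →L[ℝ] G₁} {h₂' : X → X →L[ℝ] G₂}
    {C₂ : Set G₂} {x₀ : X} {c₁ : G₁} {r R κ σ : ℝ} {L : NNReal}
    (hr : 0 < r) (hR : 0 < R) (hσ : 0 < σ) (hκ : 0 ≤ κ)
    (hC : IsClosed (C₂ ∩ Metric.closedBall (h₂ x₀) R)) (hx₀ : h₂ x₀ ∈ C₂)
    (hcalm : ∀ x ∈ Metric.closedBall x₀ r, ∀ c ∈ C₂,
      Metric.infDist x {x | h₂ x ∈ C₂} ≤ κ * ‖h₂ x - c‖)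
    (hmin : ∀ x ∈ Metric.ball x₀ (3 * r), h₂ x ∈ C₂ →
      ‖h₁ x₀ - c₁‖ ≤ ‖h₁ x - c₁‖ + σ * ‖x - x₀‖)
    (hLip : LipschitzOnWith L h₁ (Metric.ball x₀ (3 * r)))
    (hd₁ : ∀ x ∈ Metric.closedBall x₀ r, HasFDerivAt h₁ (h₁' x) x)
    (hd₂ : ∀ x ∈ Metric.closedBall x₀ r, HasFDerivAt h₂ (h₂' x) x)
    (hc₁' : ContinuousAt h₁' x₀) (hc₂' : ContinuousAt h₂' x₀)
    (hne : h₁ x₀ ≠ c₁) {ε : ℝ} (hε : 0 < ε) :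
    ∃ c₂ ∈ C₂, ∃ lam₂ ∈ regularNormalCone C₂ c₂, ‖c₂ - h₂ x₀‖ ≤ ε ∧
      ‖lam₂‖ ≤ 2 * ((L + σ) * κ) ∧
      ‖innerSL ℝ (‖h₁ x₀ - c₁‖⁻¹ • (h₁ x₀ - c₁)) ∘L h₁' x₀ + innerSL ℝ lam₂ ∘L h₂' x₀‖
        ≤ 2 * σ + ε := by
  set M : ℝ := (L + σ) * κ with hM
  have hM0 : 0 ≤ M := by positivity
  have hx₀r : x₀ ∈ Metric.closedBall x₀ r := Metric.mem_closedBall_self hr.le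
  have hcont₁ : ContinuousAt h₁ x₀ := (hd₁ x₀ hx₀r).continuousAt
  have hcont₂ : ContinuousAt h₂ x₀ := (hd₂ x₀ hx₀r).continuousAt
  set T : X → X →L[ℝ] ℝ := fun x => innerSL ℝ (‖h₁ x - c₁‖⁻¹ • (h₁ x - c₁)) ∘L h₁' x with hT
  have hTc : ContinuousAt T x₀ := by
    have h0 : ContinuousAt (fun x => h₁ x - c₁) x₀ := hcont₁.sub continuousAt_const
    have h1 : ContinuousAt (fun x => ‖h₁ x - c₁‖⁻¹ • (h₁ x - c₁)) x₀ :=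
      (h0.norm.inv₀ (norm_ne_zero_iff.2 (sub_ne_zero.2 hne))).smul h0
    have h2 : ContinuousAt (fun x => innerSL ℝ (‖h₁ x - c₁‖⁻¹ • (h₁ x - c₁))) x₀ :=
      (innerSL ℝ (E := G₁)).continuous.continuousAt.comp h1
    exact h2.clm_comp hc₁'
  have hmn : 0 < min ε R / 2 := by have := lt_min hε hR; positivity
  have hev : ∀ᶠ x in 𝓝 x₀, h₁ x ≠ c₁ ∧ ‖h₂ x - h₂ x₀‖ < min ε R / 2 ∧ ‖T x - T x₀‖ < ε / 2 ∧
      2 * M * ‖h₂' x - h₂' x₀‖ < ε / 2 := by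
    refine (hcont₁.eventually_ne hne).and (((Metric.tendsto_nhds.1 hcont₂ _ hmn).mono
      fun x hx => by rwa [← dist_eq_norm]).and
      (((Metric.tendsto_nhds.1 hTc _ (half_pos hε)).mono
      fun x hx => by rwa [← dist_eq_norm]).and ?_))
    have : ContinuousAt (fun x => 2 * M * ‖h₂' x - h₂' x₀‖) x₀ :=
      continuousAt_const.mul (hc₂'.sub continuousAt_const).norm
    refine this.eventually_lt continuousAt_const ?_
    simpa using half_pos hε
  obtain ⟨ρ₀, hρ₀, hball⟩ := Metric.eventually_nhds_iff_ball.1 hev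
  set ρ := min ρ₀ r with hρ
  have hρpos : 0 < ρ := lt_min hρ₀ hr
  have hjt1 : Tendsto (fun j : ℝ => 2 * M / j) atTop (𝓝 0) := tendsto_const_nhds.div_atTop tendsto_id
  have hjt2 : Tendsto (fun j : ℝ => M * (2 * M / j) / σ) atTop (𝓝 0) := by
    simpa using (hjt1.const_mul M).div_const σ
  -- A large penalty weight `j` forces both the violation of `h₂ x ∈ C₂` and the displacement from
  -- `x₀` below their thresholds.
  obtain ⟨j, hj0, hj1, hj2⟩ := ((eventually_gt_atTop (0 : ℝ)).and
    ((hjt1.eventually_lt_const hmn).and (hjt2.eventually_lt_const hρpos))).exists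
  have hcomp : IsCompact (Metric.closedBall x₀ r ×ˢ (C₂ ∩ Metric.closedBall (h₂ x₀) R)) :=
    (isCompact_closedBall x₀ r).prod
      ((isCompact_closedBall _ R).of_isClosed_subset hC inter_subset_right)
  have hx₀mem : (x₀, h₂ x₀) ∈ Metric.closedBall x₀ r ×ˢ (C₂ ∩ Metric.closedBall (h₂ x₀) R) :=
    ⟨hx₀r, hx₀, Metric.mem_closedBall_self hR.le⟩
  have hco₁ : ContinuousOn h₁ (Metric.closedBall x₀ r) := fun x hx =>
    (hd₁ x hx).continuousAt.continuousWithinAt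
  have hco₂ : ContinuousOn h₂ (Metric.closedBall x₀ r) := fun x hx =>
    (hd₂ x hx).continuousAt.continuousWithinAt
  obtain ⟨⟨x, c⟩, ⟨hx, hcC, hcR⟩, hopt⟩ := hcomp.exists_isMinOn ⟨_, hx₀mem⟩
    -- The weight `2 * σ` instead of `σ` leaves a surplus `σ * ‖x - x₀‖` after comparison with the
    -- exact penalty, which localizes the minimizer near `x₀`.
    (f := fun z : X × G₂ => ‖h₁ z.1 - c₁‖ + 2 * σ * ‖z.1 - x₀‖ + j / 2 * ‖h₂ z.1 - z.2‖ ^ 2) (by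
      have e1 : ContinuousOn (fun z : X × G₂ => h₁ z.1)
          (Metric.closedBall x₀ r ×ˢ (C₂ ∩ Metric.closedBall (h₂ x₀) R)) :=
        hco₁.comp continuousOn_fst fun z hz => hz.1
      have e2 : ContinuousOn (fun z : X × G₂ => h₂ z.1)
          (Metric.closedBall x₀ r ×ˢ (C₂ ∩ Metric.closedBall (h₂ x₀) R)) :=
        hco₂.comp continuousOn_fst fun z hz => hz.1
      have e3 : ContinuousOn (fun z : X × G₂ => 2 * σ * ‖z.1 - x₀‖)
          (Metric.closedBall x₀ r ×ˢ (C₂ ∩ Metric.closedBall (h₂ x₀) R)) := by fun_prop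
      exact ((e1.sub continuousOn_const).norm.add e3).add
        (((e2.sub continuousOn_snd).norm.pow 2).const_mul (j / 2)))
  simp only at hx hcC hcR
  have hopt' : ∀ y ∈ Metric.closedBall x₀ r, ∀ d ∈ C₂ ∩ Metric.closedBall (h₂ x₀) R,
      ‖h₁ x - c₁‖ + 2 * σ * ‖x - x₀‖ + j / 2 * ‖h₂ x - c‖ ^ 2 ≤
      ‖h₁ y - c₁‖ + 2 * σ * ‖y - x₀‖ + j / 2 * ‖h₂ y - d‖ ^ 2 := fun y hy d hd =>
    hopt (a := (y, d)) ⟨hy, hd⟩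
  set q := ‖h₂ x - c‖ with hq
  have hval := hopt' x₀ hx₀r (h₂ x₀) hx₀mem.2
  have hpen := exact_penalty hr hσ hx₀ hcalm hmin hLip hx hcC
  simp only [sub_self, norm_zero, mul_zero, add_zero, ne_eq, OfNat.ofNat_ne_zero,
    not_false_eq_true, zero_pow] at hval
  have hkey : σ * ‖x - x₀‖ + j / 2 * q ^ 2 ≤ M * q := by
    rw [← hM, ← hq] at hpen; linarith
  have hq0 : 0 ≤ q := norm_nonneg _
  have hxx0 : 0 ≤ σ * ‖x - x₀‖ := by positivity
  -- The multiplier `j • (h₂ x - c)` is bounded independently of `j`, because exact penalization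
  -- makes the gain at most linear in `q`.
  have hjq : j * q ≤ 2 * M := by
    rcases hq0.eq_or_lt with h | h
    · rw [← h]; simpa using hM0
    · have : q * (j * q) ≤ q * (2 * M) := by nlinarith
      exact le_of_mul_le_mul_left this h
  have hqle : q ≤ 2 * M / j := by rw [le_div_iff₀ hj0]; linarith
  have hxρ : ‖x - x₀‖ < ρ := by
    refine lt_of_le_of_lt ?_ hj2
    rw [le_div_iff₀ hσ]
    have : 0 ≤ j / 2 * q ^ 2 := by positivity
    have := mul_le_mul_of_nonneg_left hqle hM0
    linarith
  obtain ⟨hxne, hx2, hxT, hx2'⟩ := hball x (by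
    rw [mem_ball_iff_norm]; exact hxρ.trans_le (min_le_left _ _))
  have hxr : x ∈ Metric.ball x₀ r := by
    rw [mem_ball_iff_norm]; exact hxρ.trans_le (min_le_right _ _)
  have hcx : ‖c - h₂ x₀‖ < min ε R := by
    calc ‖c - h₂ x₀‖ = ‖(h₂ x - h₂ x₀) - (h₂ x - c)‖ := by congr 1; abel
      _ ≤ ‖h₂ x - h₂ x₀‖ + q := norm_sub_le _ _
      _ < min ε R := by linarith
  have hlamn : ‖j • (h₂ x - c)‖ ≤ 2 * M := by
    rwa [norm_smul, Real.norm_eq_abs, abs_of_pos hj0]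
  refine ⟨c, hcC, j • (h₂ x - c), ?_, hcx.le.trans (min_le_left _ _), hlamn, ?_⟩
  · refine smul_sub_mem_regularNormalCone ?_ hj0.le
    have hcb : c ∈ Metric.ball (h₂ x₀) R := by
      rw [mem_ball_iff_norm]; exact hcx.trans_le (min_le_right _ _)
    filter_upwards [Metric.isOpen_ball.mem_nhds hcb] with d hd hdC
    have h1 := hopt' x hx d ⟨hdC, Metric.ball_subset_closedBall hd⟩
    have h2 : ‖h₂ x - c‖ ^ 2 ≤ ‖h₂ x - d‖ ^ 2 := by
      have : j / 2 * ‖h₂ x - c‖ ^ 2 ≤ j / 2 * ‖h₂ x - d‖ ^ 2 := by linarith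
      exact le_of_mul_le_mul_left this (by positivity)
    exact (pow_le_pow_iff_left₀ (norm_nonneg _) (norm_nonneg _) two_ne_zero).1 h2
  · have hn0 : ‖h₁ x - c₁‖ ≠ 0 := norm_ne_zero_iff.2 (sub_ne_zero.2 hxne)
    have hs : HasFDerivAt (fun y => ‖h₁ y - c₁‖ + j / 2 * ‖h₂ y - c‖ ^ 2)
        (T x + innerSL ℝ (j • (h₂ x - c)) ∘L h₂' x) x := by
      have e1 : HasFDerivAt (fun y => ‖h₁ y - c₁‖ ^ 2)
          (2 • (innerSL ℝ (h₁ x - c₁) ∘L h₁' x)) x := by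
        simpa using ((hd₁ x hx).sub_const c₁).norm_sq
      have e2 : HasFDerivAt (fun y => ‖h₂ y - c‖ ^ 2)
          (2 • (innerSL ℝ (h₂ x - c) ∘L h₂' x)) x := by
        simpa using ((hd₂ x hx).sub_const c).norm_sq
      have e3 := e1.sqrt (by positivity)
      simp only [Real.sqrt_sq (norm_nonneg _)] at e3
      refine (e3.add (e2.const_mul (j / 2))).congr_fderiv ?_
      ext v
      simp [hT]
      field_simp
    have hbound := norm_fderiv_le_of_eventually_le (a := 2 * σ) (by positivity) hs (by
      filter_upwards [Metric.isOpen_ball.mem_nhds hxr] with y hy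
      have h1 := hopt' y (Metric.ball_subset_closedBall hy) c ⟨hcC, hcR⟩
      have h2 : ‖y - x₀‖ ≤ ‖x - x₀‖ + ‖y - x‖ := by
        calc ‖y - x₀‖ = ‖(x - x₀) + (y - x)‖ := by congr 1; abel
          _ ≤ _ := norm_add_le _ _
      have h3 := mul_le_mul_of_nonneg_left h2 hσ.le
      linarith)
    -- Stationarity holds at the penalty minimizer `x`; continuity of the derivatives carries it to
    -- `x₀` with error `ε`.
    have hdecomp : T x₀ + innerSL ℝ (j • (h₂ x - c)) ∘L h₂' x₀ =
        (T x + innerSL ℝ (j • (h₂ x - c)) ∘L h₂' x) - (T x - T x₀) -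
          innerSL ℝ (j • (h₂ x - c)) ∘L (h₂' x - h₂' x₀) := by
      ext v; simp
    rw [hdecomp]
    have h1 : ‖innerSL ℝ (j • (h₂ x - c)) ∘L (h₂' x - h₂' x₀)‖ ≤ 2 * M * ‖h₂' x - h₂' x₀‖ := by
      refine (ContinuousLinearMap.opNorm_comp_le _ _).trans ?_
      rw [innerSL_apply_norm]
      gcongr
    refine (norm_sub_le _ _).trans ?_
    have := norm_sub_le (T x + innerSL ℝ (j • (h₂ x - c)) ∘L h₂' x) (T x - T x₀)
    linarith

theorem isClosed_inter_closedBall_of_norm_sub_add_le {E : Type*} [NormedAddCommGroup E]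
    [InnerProductSpace ℝ E]
    {C : Set E} {z y : E} {R s : ℝ} (hC : IsClosed (C ∩ Metric.closedBall z R))
    (h : ‖y - z‖ + s ≤ R) : IsClosed (C ∩ Metric.closedBall y s) := by
  have : C ∩ Metric.closedBall y s = (C ∩ Metric.closedBall z R) ∩ Metric.closedBall y s := by
    have hsub : Metric.closedBall y s ⊆ Metric.closedBall z R :=
      Metric.closedBall_subset_closedBall' (by rw [dist_eq_norm]; linarith)
    rw [inter_assoc, inter_eq_self_of_subset_right hsub]
  rw [this]
  exact hC.inter Metric.isClosed_closedBall

/-! ### Robinson stability in terms of points. -/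

section RobinsonStability

variable {E F G : Type*} [NormedAddCommGroup E] [NormedAddCommGroup F] [NormedAddCommGroup G]
  {P : Set E} {g : E × F → G} {C : Set G} {p₀ : E} {x₀ : F}

/-- Since `C` is nonempty the right side of the stability estimate is finite, so `Γ(p)` is nonempty;
the strict bound `d` avoids needing a nearest solution. -/
theorem RobinsonStable.exists_solution (h : RobinsonStable P g C p₀ x₀) (hC : C.Nonempty) :
    ∃ κ : NNReal, ∃ ρ > 0, ∀ p ∈ P, ‖p - p₀‖ < ρ → ∀ x, ‖x - x₀‖ < ρ →
      ∀ d, κ * Metric.infDist (g (p, x)) C < d → ∃ x', g (p, x') ∈ C ∧ ‖x - x'‖ < d := by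
  obtain ⟨κ, U, hU, V, hV, h⟩ := h
  obtain ⟨ρ₁, hρ₁, h₁⟩ := Metric.mem_nhds_iff.1 hU
  obtain ⟨ρ₂, hρ₂, h₂⟩ := Metric.mem_nhds_iff.1 hV
  refine ⟨κ, min ρ₁ ρ₂, lt_min hρ₁ hρ₂, fun p hp hpd x hxd d hd => ?_⟩
  have h3 := h p ⟨hp, h₂ (mem_ball_iff_norm.2 (hpd.trans_le (min_le_right _ _)))⟩ x
    (h₁ (mem_ball_iff_norm.2 (hxd.trans_le (min_le_left _ _))))
  have h4 : Metric.infEDist x (solutionSet g C p) < ENNReal.ofReal d := by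
    refine h3.trans_lt ?_
    have h0 : 0 ≤ κ * Metric.infDist (g (p, x)) C := by
      have := Metric.infDist_nonneg (x := g (p, x)) (s := C)
      positivity
    calc (κ : ENNReal) * Metric.infEDist (g (p, x)) C
        = ENNReal.ofReal (κ * Metric.infDist (g (p, x)) C) := by
          rw [ENNReal.ofReal_mul κ.coe_nonneg, Metric.infDist,
            ENNReal.ofReal_toReal (Metric.infEDist_ne_top hC), ENNReal.ofReal_coe_nnreal]
      _ < ENNReal.ofReal d := (ENNReal.ofReal_lt_ofReal_iff (h0.trans_lt hd)).2 hd
  obtain ⟨x', hx', hlt⟩ := Metric.infEDist_lt_iff.1 h4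
  refine ⟨x', hx', ?_⟩
  rw [edist_dist] at hlt
  rw [← dist_eq_norm]
  exact (ENNReal.ofReal_lt_ofReal_iff_of_nonneg dist_nonneg).1 hlt

theorem exists_lt_dist_of_not_robinsonStable (h : ¬ RobinsonStable P g C p₀ x₀)
    (hC : C.Nonempty) (κ : NNReal) {ρ : ℝ} (hρ : 0 < ρ) :
    ∃ p ∈ P, ∃ x, ‖p - p₀‖ < ρ ∧ ‖x - x₀‖ < ρ ∧
      ∀ x', g (p, x') ∈ C → κ * Metric.infDist (g (p, x)) C < ‖x - x'‖ := by
  by_contra! hcon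
  refine h ⟨κ, Metric.ball x₀ ρ, Metric.ball_mem_nhds _ hρ, Metric.ball p₀ ρ,
    Metric.ball_mem_nhds _ hρ, fun p hp x hx => ?_⟩
  obtain ⟨x', hx', hle⟩ := hcon p hp.1 x (mem_ball_iff_norm.1 hp.2) (mem_ball_iff_norm.1 hx)
  calc Metric.infEDist x (solutionSet g C p) ≤ edist x x' := Metric.infEDist_le_edist_of_mem hx'
    _ = ENNReal.ofReal ‖x - x'‖ := by rw [edist_dist, dist_eq_norm]
    _ ≤ ENNReal.ofReal (κ * Metric.infDist (g (p, x)) C) := ENNReal.ofReal_le_ofReal hle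
    _ = κ * Metric.infEDist (g (p, x)) C := by
      rw [ENNReal.ofReal_mul κ.coe_nonneg, Metric.infDist,
        ENNReal.ofReal_toReal (Metric.infEDist_ne_top hC), ENNReal.ofReal_coe_nnreal]

end RobinsonStability

/-- Strict differentiability provides one Lipschitz constant for `g` near the reference pair,
jointly in `p` and `x`. -/
theorem TwiceDifferentiableAt.hasStrictFDerivAt {E G : Type*} [NormedAddCommGroup E]
    [NormedSpace ℝ E] [NormedAddCommGroup G] [NormedSpace ℝ G] {f : E → G} {z : E}
    (h : TwiceDifferentiableAt f z) : HasStrictFDerivAt f (fderiv ℝ f z) z :=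
  hasStrictFDerivAt_of_hasFDerivAt_of_continuousAt (h.1.mono fun _ hy => hy.hasFDerivAt)
    h.2.continuousAt

/-! ### Orthogonal splitting of the image space. -/

section OrthogonalProduct

variable {G G₁ G₂ : Type*} [NormedAddCommGroup G] [InnerProductSpace ℝ G]
  [NormedAddCommGroup G₁] [InnerProductSpace ℝ G₁] [NormedAddCommGroup G₂] [InnerProductSpace ℝ G₂]
  {e : G ≃L[ℝ] G₁ × G₂} {C₁ : Set G₁} {C₂ : Set G₂}

/-- The type `G₁ × G₂` carries the sup norm, so metric facts must pass through the inner product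
identity `he` rather than through an isometry. -/
theorem norm_sq_eq_add_of_inner_eq
    (he : ∀ x y, inner ℝ x y = inner ℝ (e x).1 (e y).1 + inner ℝ (e x).2 (e y).2) (x : G) :
    ‖x‖ ^ 2 = ‖(e x).1‖ ^ 2 + ‖(e x).2‖ ^ 2 := by
  rw [← real_inner_self_eq_norm_sq, ← real_inner_self_eq_norm_sq, ← real_inner_self_eq_norm_sq, he]

theorem norm_fst_le_of_inner_eq
    (he : ∀ x y, inner ℝ x y = inner ℝ (e x).1 (e y).1 + inner ℝ (e x).2 (e y).2) (x : G) :
    ‖(e x).1‖ ≤ ‖x‖ := by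
  refine (pow_le_pow_iff_left₀ (norm_nonneg _) (norm_nonneg _) two_ne_zero).1 ?_
  rw [norm_sq_eq_add_of_inner_eq he]
  exact le_add_of_nonneg_right (sq_nonneg _)

theorem norm_snd_le_of_inner_eq
    (he : ∀ x y, inner ℝ x y = inner ℝ (e x).1 (e y).1 + inner ℝ (e x).2 (e y).2) (x : G) :
    ‖(e x).2‖ ≤ ‖x‖ := by
  refine (pow_le_pow_iff_left₀ (norm_nonneg _) (norm_nonneg _) two_ne_zero).1 ?_
  rw [norm_sq_eq_add_of_inner_eq he]
  exact le_add_of_nonneg_left (sq_nonneg _)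

theorem norm_le_add_of_inner_eq
    (he : ∀ x y, inner ℝ x y = inner ℝ (e x).1 (e y).1 + inner ℝ (e x).2 (e y).2) (x : G) :
    ‖x‖ ≤ ‖(e x).1‖ + ‖(e x).2‖ := by
  refine (pow_le_pow_iff_left₀ (norm_nonneg _) (by positivity) two_ne_zero).1 ?_
  rw [norm_sq_eq_add_of_inner_eq he]
  nlinarith [norm_nonneg (e x).1, norm_nonneg (e x).2]

theorem infDist_fst_le_of_inner_eq
    (he : ∀ x y, inner ℝ x y = inner ℝ (e x).1 (e y).1 + inner ℝ (e x).2 (e y).2)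
    (hne : (e ⁻¹' (C₁ ×ˢ C₂)).Nonempty) (y : G) :
    Metric.infDist (e y).1 C₁ ≤ Metric.infDist y (e ⁻¹' (C₁ ×ˢ C₂)) :=
  (Metric.le_infDist hne).2 fun {c} hc => (Metric.infDist_le_dist_of_mem hc.1).trans (by
    simpa [dist_eq_norm] using norm_fst_le_of_inner_eq he (y - c))

theorem infDist_snd_le_of_inner_eq
    (he : ∀ x y, inner ℝ x y = inner ℝ (e x).1 (e y).1 + inner ℝ (e x).2 (e y).2)
    (hne : (e ⁻¹' (C₁ ×ˢ C₂)).Nonempty) (y : G) :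
    Metric.infDist (e y).2 C₂ ≤ Metric.infDist y (e ⁻¹' (C₁ ×ˢ C₂)) :=
  (Metric.le_infDist hne).2 fun {c} hc => (Metric.infDist_le_dist_of_mem hc.2).trans (by
    simpa [dist_eq_norm] using norm_snd_le_of_inner_eq he (y - c))

/-- Tangents to a product have tangent components, along the same step sizes; this inclusion alone
yields the inclusion between polars needed here. -/
theorem mem_regularNormalCone_preimage_prod
    (he : ∀ x y, inner ℝ x y = inner ℝ (e x).1 (e y).1 + inner ℝ (e x).2 (e y).2) {c lam : G}
    (h₁ : (e lam).1 ∈ regularNormalCone C₁ (e c).1)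
    (h₂ : (e lam).2 ∈ regularNormalCone C₂ (e c).2) :
    lam ∈ regularNormalCone (e ⁻¹' (C₁ ×ˢ C₂)) c := by
  rintro u ⟨t, u', htpos, ht, hu, hmem⟩
  have hu' : Tendsto (fun k => e (u' k)) atTop (𝓝 (e u)) := (e.continuous.tendsto u).comp hu
  have e1 := h₁ (e u).1 ⟨t, _, htpos, ht, (continuous_fst.tendsto _).comp hu', fun k => by
    simpa using (hmem k).1⟩
  have e2 := h₂ (e u).2 ⟨t, _, htpos, ht, (continuous_snd.tendsto _).comp hu', fun k => by
    simpa using (hmem k).2⟩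
  rw [he]
  exact add_nonpos e1 e2

end OrthogonalProduct

/-! ### Approximate KKT points when stability fails. -/

/-- From a point `x` that is far from the solution set of `h₁ x ∈ C₁`, `h₂ x ∈ C₂` compared with its
residual `D`, one gets a nearby minimizer of a penalized residual of the first constraint subject to
the second one, together with approximate multipliers. -/
theorem exists_penalized_minimizer {X G₁ G₂ : Type*} [NormedAddCommGroup X] [NormedSpace ℝ X]
    [ProperSpace X] [NormedAddCommGroup G₁] [InnerProductSpace ℝ G₁]
    [NormedAddCommGroup G₂] [InnerProductSpace ℝ G₂] [ProperSpace G₂]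
    {h₁ : X → G₁} {h₂ : X → G₂} {C₁ : Set G₁} {C₂ : Set G₂} {x₀ x : X} {z₂ : G₂}
    {ρ R₂ σ η δ D : ℝ} {L κ : NNReal} (hρ : 0 < ρ) (hσ : 0 < σ)
    (hcl₂ : IsClosed (C₂ ∩ Metric.closedBall z₂ R₂))
    (hz₂ : ∀ y, ‖y - x₀‖ < ρ → ‖h₂ y - z₂‖ < R₂ / 2)
    (hnear₁ : ∀ y, ‖y - x₀‖ < ρ → ∃ c ∈ C₁, ‖h₁ y - c‖ = Metric.infDist (h₁ y) C₁ ∧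
        ∀ c' ∈ C₁, ‖h₁ y - c‖ ≤ ‖h₁ y - c'‖)
    (hLip : ∀ y, ‖y - x₀‖ < ρ → ∀ z, ‖z - x₀‖ < ρ → ‖h₁ y - h₁ z‖ ≤ L * ‖y - z‖)
    (hC1₁ : ∀ y, ‖y - x₀‖ < ρ → ContDiffAt ℝ 1 h₁ y)
    (hC1₂ : ∀ y, ‖y - x₀‖ < ρ → ContDiffAt ℝ 1 h₂ y)
    (hκ : ∀ y, ‖y - x₀‖ < ρ → ∀ d, κ * Metric.infDist (h₂ y) C₂ < d →
      ∃ x', h₂ x' ∈ C₂ ∧ ‖y - x'‖ < d)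
    (hxη : ‖x - x₀‖ ≤ η) (hDpos : 0 < D) (hDη : D ≤ L * η)
    (hD1 : Metric.infDist (h₁ x) C₁ ≤ D) (hD2 : Metric.infDist (h₂ x) C₂ ≤ D)
    (hfar : ∀ x', h₁ x' ∈ C₁ → h₂ x' ∈ C₂ →
      (κ + 1 + (1 + L * (κ + 1)) / σ) * D < ‖x - x'‖)
    (hδρ : δ ≤ ρ / 4)
    (hηδ : η * (1 + (κ + 1) * L + (1 + L * (κ + 1)) * L / σ) ≤ δ) :
    ∃ x₃, ∃ c₁ ∈ C₁, ‖x₃ - x₀‖ ≤ δ ∧ h₂ x₃ ∈ C₂ ∧ h₁ x₃ ∉ C₁ ∧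
      (∀ c' ∈ C₁, ‖h₁ x₃ - c₁‖ ≤ ‖h₁ x₃ - c'‖) ∧
      (∀ y, ‖y - x₀‖ ≤ ρ / 2 → h₂ y ∈ C₂ →
        ‖h₁ x₃ - c₁‖ ≤ Metric.infDist (h₁ y) C₁ + σ * ‖y - x₃‖) ∧
      ∀ θ > 0, ∃ c₂ ∈ C₂, ∃ lam₂ ∈ regularNormalCone C₂ c₂, ‖c₂ - h₂ x₃‖ ≤ θ ∧
        ‖lam₂‖ ≤ 2 * ((L + σ) * κ) ∧
        ‖innerSL ℝ (‖h₁ x₃ - c₁‖⁻¹ • (h₁ x₃ - c₁)) ∘L fderiv ℝ h₁ x₃ +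
          innerSL ℝ lam₂ ∘L fderiv ℝ h₂ x₃‖ ≤ 2 * σ + θ := by
  set b : ℝ := 1 + L * (κ + 1) with hb
  have hb0 : 0 ≤ b := by positivity
  have hη0 : 0 ≤ η := (norm_nonneg _).trans hxη
  have hbση : 0 ≤ η * (b * L / σ) := by positivity
  have hκη : 0 ≤ (κ + 1) * (L * η) := by positivity
  have hηδ' : η + (κ + 1) * (L * η) + η * (b * L / σ) ≤ δ := by
    calc _ = η * (1 + (κ + 1) * L + b * L / σ) := by ring
      _ ≤ _ := hηδ
  have hxρ : ‖x - x₀‖ < ρ := by linarith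
  have htri : ∀ u v w : X, ‖u - w‖ ≤ ‖u - v‖ + ‖v - w‖ :=
    fun u v w => norm_sub_le_norm_sub_add_norm_sub u v w
  -- correct `x` to satisfy the second constraint
  obtain ⟨x₂, hx₂C, hxx₂⟩ := hκ x hxρ ((κ + 1) * D) (by
      have := mul_le_mul_of_nonneg_left hD2 κ.coe_nonneg
      linarith)
  have hκD : (κ + 1) * D ≤ (κ + 1) * (L * η) := by gcongr
  have hx₂0 : ‖x₂ - x₀‖ ≤ η + (κ + 1) * (L * η) := by
    have := htri x₂ x x₀
    rw [norm_sub_rev x₂ x] at this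
    linarith
  have hx₂ρ : ‖x₂ - x₀‖ ≤ ρ / 2 := by linarith
  have hφx₂ : Metric.infDist (h₁ x₂) C₁ ≤ b * D := by
    have h1 := Metric.infDist_le_infDist_add_dist (s := C₁) (x := h₁ x₂) (y := h₁ x)
    rw [dist_eq_norm] at h1
    have h2 := hLip x₂ (by linarith) x hxρ
    rw [norm_sub_rev x₂ x] at h2
    have h3 := mul_le_mul_of_nonneg_left hxx₂.le L.coe_nonneg
    calc _ ≤ D + L * ((κ + 1) * D) := by linarith
      _ = b * D := by rw [hb]; ring
  -- minimize the penalized distance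
  have hcont₁ : ContinuousOn h₁ (Metric.closedBall x₀ (ρ / 2)) := fun y hy =>
    (hC1₁ y (by have := mem_closedBall_iff_norm.1 hy; linarith)).continuousAt.continuousWithinAt
  have hcont₂ : ContinuousOn h₂ (Metric.closedBall x₀ (ρ / 2)) := fun y hy =>
    (hC1₂ y (by have := mem_closedBall_iff_norm.1 hy; linarith)).continuousAt.continuousWithinAt
  have hScl : IsClosed (Metric.closedBall x₀ (ρ / 2) ∩ h₂ ⁻¹' C₂) := by
    have h1 := hcont₂.preimage_isClosed_of_isClosed Metric.isClosed_closedBall hcl₂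
    convert h1 using 1
    ext y
    refine ⟨fun hy => ⟨hy.1, hy.2, ?_⟩, fun hy => ⟨hy.1, hy.2.1⟩⟩
    have hyρ : ‖y - x₀‖ < ρ := by have := mem_closedBall_iff_norm.1 hy.1; linarith
    rw [mem_closedBall_iff_norm]
    linarith [hz₂ y hyρ, norm_nonneg (h₂ y - z₂)]
  have hScomp : IsCompact (Metric.closedBall x₀ (ρ / 2) ∩ h₂ ⁻¹' C₂) :=
    (isCompact_closedBall _ _).of_isClosed_subset hScl inter_subset_left
  have hx₂S : x₂ ∈ Metric.closedBall x₀ (ρ / 2) ∩ h₂ ⁻¹' C₂ :=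
    ⟨mem_closedBall_iff_norm.2 hx₂ρ, hx₂C⟩
  obtain ⟨x₃, ⟨hx₃b, hx₃C⟩, hopt⟩ := hScomp.exists_isMinOn ⟨x₂, hx₂S⟩
    (f := fun y => Metric.infDist (h₁ y) C₁ + σ * ‖y - x₂‖) (by
      refine (((Metric.continuous_infDist_pt C₁).comp_continuousOn hcont₁).mono
        inter_subset_left).add ?_
      fun_prop)
  have hopt' : ∀ y, ‖y - x₀‖ ≤ ρ / 2 → h₂ y ∈ C₂ →
      Metric.infDist (h₁ x₃) C₁ + σ * ‖x₃ - x₂‖ ≤ Metric.infDist (h₁ y) C₁ + σ * ‖y - x₂‖ :=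
    fun y hy hyC => hopt ⟨mem_closedBall_iff_norm.2 hy, hyC⟩
  have hval := (hopt' x₂ hx₂ρ hx₂C)
  rw [sub_self, norm_zero, mul_zero, add_zero] at hval
  have hφ0 : 0 ≤ Metric.infDist (h₁ x₃) C₁ := Metric.infDist_nonneg
  have hx₃₂ : ‖x₃ - x₂‖ ≤ b / σ * D := by
    rw [div_mul_eq_mul_div, le_div_iff₀ hσ]; linarith
  have hx₃d : ‖x₃ - x₀‖ ≤ δ := by
    have h1 : b / σ * D ≤ b / σ * (L * η) := by gcongr
    have h2 : b / σ * (L * η) = η * (b * L / σ) := by ring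
    linarith [htri x₃ x₂ x₀]
  have hx₃ρ : ‖x₃ - x₀‖ < ρ := by linarith
  -- The constant in `hfar` is the total displacement: `(κ + 1) * D` from `x` to `x₂` and `b / σ *
  -- D` from `x₂` to `x₃`.
  have hx₃not : h₁ x₃ ∉ C₁ := fun h => by
    have h1 := hfar x₃ h hx₃C
    have h2 := htri x x₂ x₃
    rw [norm_sub_rev x₂ x₃] at h2
    have h3 : (κ + 1 + b / σ) * D = (κ + 1) * D + b / σ * D := by ring
    linarith
  obtain ⟨c₁, hc₁, hc₁eq, hc₁min⟩ := hnear₁ x₃ hx₃ρ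
  have hc₁ne : h₁ x₃ ≠ c₁ := fun h => hx₃not (h ▸ hc₁)
  have hoptx : ∀ y, ‖y - x₀‖ ≤ ρ / 2 → h₂ y ∈ C₂ →
      ‖h₁ x₃ - c₁‖ ≤ Metric.infDist (h₁ y) C₁ + σ * ‖y - x₃‖ := fun y hy hyC => by
    have h1 := hopt' y hy hyC
    have h2 := mul_le_mul_of_nonneg_left (htri y x₃ x₂) hσ.le
    linarith
  have hsmall : ∀ y, ‖y - x₃‖ ≤ ρ / 4 → ‖y - x₀‖ ≤ ρ / 2 := fun y hy => by
    linarith [htri y x₃ x₀]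
  refine ⟨x₃, c₁, hc₁, hx₃d, hx₃C, hx₃not, hc₁min, hoptx, fun θ hθ => ?_⟩
  have hR₂ : 0 < R₂ / 2 := (norm_nonneg _).trans_lt (hz₂ x₃ hx₃ρ)
  have hsmall' : ∀ y ∈ Metric.closedBall x₃ (ρ / 12), ‖y - x₀‖ < ρ := fun y hy => by
    have := hsmall y (by have := mem_closedBall_iff_norm.1 hy; linarith)
    linarith
  -- With radius `ρ / 12`, the ball of radius `3 * r = ρ / 4` about `x₃` stays in the region where
  -- `x₃` is known to be optimal.
  refine exists_approximate_multiplier (r := ρ / 12) (R := R₂ / 2) (L := L)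
    (by positivity) hR₂ hσ κ.coe_nonneg
    (isClosed_inter_closedBall_of_norm_sub_add_le hcl₂ (by linarith [hz₂ x₃ hx₃ρ]))
    hx₃C (fun y hy c hc => ?_) (fun y hy hyC => ?_)
    (LipschitzOnWith.of_dist_le_mul fun y hy z hz => ?_)
    (fun y hy => ((hC1₁ y (hsmall' y hy)).differentiableAt one_ne_zero).hasFDerivAt)
    (fun y hy => ((hC1₂ y (hsmall' y hy)).differentiableAt one_ne_zero).hasFDerivAt)
    ((hC1₁ x₃ hx₃ρ).fderiv_right (m := 0) (by norm_num)).continuousAt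
    ((hC1₂ x₃ hx₃ρ).fderiv_right (m := 0) (by norm_num)).continuousAt hc₁ne hθ
  · refine le_of_forall_gt_imp_ge_of_dense fun d hd => ?_
    obtain ⟨x', hx', hlt⟩ := hκ y (hsmall' y hy) d (by
      refine lt_of_le_of_lt ?_ hd
      rw [← dist_eq_norm]
      gcongr
      exact Metric.infDist_le_dist_of_mem hc)
    have hx'' : x' ∈ {x | h₂ x ∈ C₂} := hx'
    refine (Metric.infDist_le_dist_of_mem hx'').trans ?_
    rw [dist_eq_norm]
    exact hlt.le
  · refine (hoptx y (hsmall y ?_) hyC).trans ?_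
    · have := mem_ball_iff_norm.1 hy; linarith
    · rw [← dist_eq_norm (h₁ y)]
      gcongr
      exact Metric.infDist_le_dist_of_mem hc₁
  · have hy0 := hsmall y (by have := mem_ball_iff_norm.1 hy; linarith)
    have hz0 := hsmall z (by have := mem_ball_iff_norm.1 hz; linarith)
    rw [dist_eq_norm, dist_eq_norm]
    exact hLip y (by linarith) z (by linarith)

/-- If Robinson stability of the whole system fails but the second subsystem is Robinson stable,
there are approximate KKT points with normalized first multiplier arbitrarily close to the
reference point. -/
theorem exists_approximate_kkt_of_not_robinsonStable {E F G G₁ G₂ : Type*}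
    [NormedAddCommGroup E] [NormedSpace ℝ E]
    [NormedAddCommGroup F] [NormedSpace ℝ F] [ProperSpace F]
    [NormedAddCommGroup G] [InnerProductSpace ℝ G]
    [NormedAddCommGroup G₁] [InnerProductSpace ℝ G₁] [ProperSpace G₁]
    [NormedAddCommGroup G₂] [InnerProductSpace ℝ G₂] [ProperSpace G₂]
    {e : G ≃L[ℝ] G₁ × G₂}
    (he : ∀ x y, inner ℝ x y = inner ℝ (e x).1 (e y).1 + inner ℝ (e x).2 (e y).2)
    {P : Set E} {g : E × F → G} {C₁ : Set G₁} {C₂ : Set G₂} {p₀ : E} {x₀ : F}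
    {g' : E × F →L[ℝ] G} (hfeas : g (p₀, x₀) ∈ e ⁻¹' (C₁ ×ˢ C₂))
    (hC₁ : LocallyClosedAround C₁ (e (g (p₀, x₀))).1)
    (hC₂ : LocallyClosedAround C₂ (e (g (p₀, x₀))).2)
    (hsmooth : ∃ U ∈ 𝓝 x₀, ∃ V ∈ 𝓝 p₀, ∀ p ∈ P ∩ V, ∀ x ∈ U,
      ContDiffAt ℝ 1 (fun y => g (p, y)) x)
    (hdiff : HasStrictFDerivAt g g' (p₀, x₀))
    (hsub : RobinsonStable P (fun z => (e (g z)).2) C₂ p₀ x₀)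
    (hnot : ¬ RobinsonStable P g (e ⁻¹' (C₁ ×ˢ C₂)) p₀ x₀) :
    ∃ K r : ℝ, 0 < r ∧ ∀ ε > 0, ∃ p ∈ P, ∃ x, ∃ c ∈ e ⁻¹' (C₁ ×ˢ C₂),
      ∃ lam ∈ regularNormalCone (e ⁻¹' (C₁ ×ˢ C₂)) c, ∃ a ≥ 0,
      (p - p₀, x - x₀) ≠ 0 ∧ ‖p - p₀‖ ≤ ε ∧ ‖x - x₀‖ ≤ ε ∧ ‖(e lam).1‖ = 1 ∧ ‖lam‖ ≤ K ∧
      (e (g (p, x))).1 - (e c).1 = a • (e lam).1 ∧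
      ‖(e c).2 - (e (g (p, x))).2‖ ≤ ε * ‖(p - p₀, x - x₀)‖ ^ 2 ∧
      ‖innerSL ℝ lam ∘L fderiv ℝ (fun y => g (p, y)) x‖ ≤ ε ∧
      ∀ x', ‖x' - x₀‖ ≤ r → (e (g (p, x'))).2 ∈ C₂ →
        a ≤ Metric.infDist (e (g (p, x'))).1 C₁ + ε * ‖x' - x‖ := by
  obtain ⟨R₁, hR₁, hcl₁⟩ := hC₁
  obtain ⟨R₂, hR₂, hcl₂⟩ := hC₂
  obtain ⟨U, hU, V, hV, hsm⟩ := hsmooth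
  have hneC : (e ⁻¹' (C₁ ×ˢ C₂)).Nonempty := ⟨_, hfeas⟩
  obtain ⟨L, s, hs, hLip⟩ := hdiff.exists_lipschitzOnWith
  obtain ⟨κ, ρ₁, hρ₁, hκ⟩ := hsub.exists_solution ⟨_, hfeas.2⟩
  have hcont : ContinuousAt g (p₀, x₀) := hdiff.hasFDerivAt.continuousAt
  have hR : 0 < min R₁ R₂ / 2 := half_pos (lt_min hR₁ hR₂)
  have hev : ∀ᶠ z in 𝓝 (p₀, x₀), z ∈ s ∧ z.2 ∈ U ∧ z.1 ∈ V ∧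
      ‖g z - g (p₀, x₀)‖ < min R₁ R₂ / 2 := by
    filter_upwards [hs, (continuous_snd.tendsto (p₀, x₀)).eventually hU,
      (continuous_fst.tendsto (p₀, x₀)).eventually hV, Metric.tendsto_nhds.1 hcont _ hR]
      with z h1 h2 h3 h4
    exact ⟨h1, h2, h3, by rwa [← dist_eq_norm]⟩
  obtain ⟨ρ₂, hρ₂, hball⟩ := Metric.eventually_nhds_iff_ball.1 hev
  set ρ := min ρ₁ ρ₂ with hρdef
  have hρ : 0 < ρ := lt_min hρ₁ hρ₂
  have hloc : ∀ p x, ‖p - p₀‖ < ρ → ‖x - x₀‖ < ρ → (p, x) ∈ s ∧ x ∈ U ∧ p ∈ V ∧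
      ‖g (p, x) - g (p₀, x₀)‖ < min R₁ R₂ / 2 := fun p x hp hx => hball (p, x) (by
    rw [mem_ball_iff_norm, Prod.norm_def]
    exact max_lt (hp.trans_le (min_le_right _ _)) (hx.trans_le (min_le_right _ _)))
  have hfst : ∀ p, ‖p - p₀‖ < ρ → ∀ x, ‖x - x₀‖ < ρ →
      ‖(e (g (p, x))).1 - (e (g (p₀, x₀))).1‖ < R₁ / 2 := fun p hp x hx => by
    have h1 := norm_fst_le_of_inner_eq he (g (p, x) - g (p₀, x₀))
    rw [map_sub, Prod.fst_sub] at h1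
    linarith [min_le_left R₁ R₂, (hloc p x hp hx).2.2.2]
  have hsnd : ∀ p, ‖p - p₀‖ < ρ → ∀ x, ‖x - x₀‖ < ρ →
      ‖(e (g (p, x))).2 - (e (g (p₀, x₀))).2‖ < R₂ / 2 := fun p hp x hx => by
    have h1 := norm_snd_le_of_inner_eq he (g (p, x) - g (p₀, x₀))
    rw [map_sub, Prod.snd_sub] at h1
    linarith [min_le_right R₁ R₂, (hloc p x hp hx).2.2.2]
  refine ⟨1 + 2 * ((L + 1) * κ), ρ / 2, half_pos hρ, fun ε hε => ?_⟩
  -- The stationarity error `2 * σ + θ` with `θ ≤ 2 * σ` is at most `ε`, while `σ ≤ 1` makes the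
  -- multiplier bound independent of `ε`.
  set σ : ℝ := min ε 1 / 4 with hσdef
  have hmin1 : 0 < min ε 1 := lt_min hε one_pos
  have hσ : 0 < σ := by positivity
  have hσε : 4 * σ ≤ ε := by linarith [min_le_left ε 1]
  have hσ1 : σ ≤ 1 := by linarith [min_le_right ε 1]
  -- `A` bounds the amplification of the initial radius `η` by both corrections, so `η * A` controls
  -- `‖x₃ - x₀‖`.
  set A : ℝ := 1 + (κ + 1) * L + (1 + L * (κ + 1)) * L / σ with hA
  have hA1 : 1 ≤ A := by
    have h1 : 0 ≤ (κ + 1) * (L : ℝ) := by positivity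
    have h2 : 0 ≤ (1 + L * ((κ : ℝ) + 1)) * L / σ := by positivity
    linarith
  have hA0 : 0 < A := by linarith
  set η : ℝ := min ε (ρ / 4) / A with hη
  have hηpos : 0 < η := div_pos (lt_min hε (by positivity)) hA0
  have hηA : η * A = min ε (ρ / 4) := div_mul_cancel₀ _ hA0.ne'
  have hηle : η ≤ min ε (ρ / 4) := by
    rw [← hηA]; exact le_mul_of_one_le_right hηpos.le hA1
  have hminρ := min_le_right ε (ρ / 4)
  have hminε := min_le_left ε (ρ / 4)
  obtain ⟨p, hpP, x, hpη, hxη, hfar⟩ := exists_lt_dist_of_not_robinsonStable hnot hneC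
    (κ + 1 + ⟨(1 + L * (κ + 1)) / σ, by positivity⟩) hηpos
  have hfar' : ∀ x', g (p, x') ∈ e ⁻¹' (C₁ ×ˢ C₂) → (κ + 1 + (1 + L * (κ + 1)) / σ) *
      Metric.infDist (g (p, x)) (e ⁻¹' (C₁ ×ˢ C₂)) < ‖x - x'‖ := hfar
  set D := Metric.infDist (g (p, x)) (e ⁻¹' (C₁ ×ˢ C₂)) with hD
  have hpρ : ‖p - p₀‖ < ρ := by linarith
  have hxρ : ‖x - x₀‖ < ρ := by linarith
  have hD1 : Metric.infDist (e (g (p, x))).1 C₁ ≤ D := infDist_fst_le_of_inner_eq he hneC _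
  have hD2 : Metric.infDist (e (g (p, x))).2 C₂ ≤ D := infDist_snd_le_of_inner_eq he hneC _
  have hnear₁ : ∀ y, ‖y - x₀‖ < ρ → _ := fun y hy =>
    exists_nearest_point hfeas.1 hcl₁ (hfst p hpρ y hy)
  have hDpos : 0 < D := by
    by_contra! hD0
    obtain ⟨d₁, hd₁, hd₁eq, -⟩ := hnear₁ x hxρ
    obtain ⟨d₂, hd₂, hd₂eq, -⟩ := exists_nearest_point hfeas.2 hcl₂ (hsnd p hpρ x hxρ)
    have h1 : ‖(e (g (p, x))).1 - d₁‖ = 0 := le_antisymm (by linarith) (norm_nonneg _)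
    have h2 : ‖(e (g (p, x))).2 - d₂‖ = 0 := le_antisymm (by linarith) (norm_nonneg _)
    rw [norm_eq_zero, sub_eq_zero] at h1 h2
    have := hfar' x ⟨by rwa [h1], by rwa [h2]⟩
    rw [sub_self, norm_zero, le_antisymm hD0 Metric.infDist_nonneg, mul_zero] at this
    exact lt_irrefl _ this
  have hDη : D ≤ L * η := by
    have h1 := Metric.infDist_le_dist_of_mem hfeas (x := g (p, x))
    have h2 := hLip.dist_le_mul _ (hloc p x hpρ hxρ).1 _ (mem_of_mem_nhds hs)
    refine h1.trans (h2.trans ?_)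
    gcongr
    rw [dist_eq_norm, Prod.norm_def]
    exact max_le hpη.le hxη.le
  have hCD : ∀ y, ‖y - x₀‖ < ρ → ContDiffAt ℝ 1 (fun z => e (g (p, z))) y := fun y hy =>
    e.contDiff.contDiffAt.comp y (hsm p ⟨hpP, (hloc p y hpρ hy).2.2.1⟩ y (hloc p y hpρ hy).2.1)
  obtain ⟨x₃, c₁, hc₁, hx₃d, hx₃C, hx₃not, hc₁min, hopt, hmult⟩ := exists_penalized_minimizer
    (h₁ := fun y => (e (g (p, y))).1) (h₂ := fun y => (e (g (p, y))).2) (C₁ := C₁) (C₂ := C₂)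
    (x := x) (L := L) (κ := κ) hρ hσ hcl₂ (hsnd p hpρ) hnear₁
    (fun y hy z hz => by
      have h1 := norm_fst_le_of_inner_eq he (g (p, y) - g (p, z))
      rw [map_sub, Prod.fst_sub] at h1
      have h2 := hLip.dist_le_mul _ (hloc p y hpρ hy).1 _ (hloc p z hpρ hz).1
      rw [dist_eq_norm, dist_eq_norm, Prod.mk_sub_mk, sub_self, Prod.norm_mk, norm_zero,
        max_eq_right (norm_nonneg _)] at h2
      exact h1.trans h2)
    (fun y hy => (hCD y hy).fst) (fun y hy => (hCD y hy).snd)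
    (fun y hy => hκ p hpP (hpρ.trans_le (min_le_left _ _)) y (hy.trans_le (min_le_left _ _)))
    hxη.le hDpos hDη hD1 hD2 (fun x' h1 h2 => hfar' x' ⟨h1, h2⟩) hminρ hηA.le
  have hx₃ρ : ‖x₃ - x₀‖ < ρ := by linarith
  have hne : (p - p₀, x₃ - x₀) ≠ 0 := fun h => by
    rw [Prod.mk_eq_zero, sub_eq_zero, sub_eq_zero] at h
    rw [h.1, h.2] at hx₃not
    exact hx₃not hfeas.1
  have ht : 0 < ‖(p - p₀, x₃ - x₀)‖ := norm_pos_iff.2 hne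
  -- The tolerance is chosen after `x₃`, so the error in the second component can be made small
  -- against the squared distance to the reference pair.
  obtain ⟨c₂, hc₂, lam₂, hlam₂, hc₂d, hlam₂n, hstat⟩ :=
    hmult (min (2 * σ) (ε * ‖(p - p₀, x₃ - x₀)‖ ^ 2)) (by positivity)
  have hn0 : ‖(e (g (p, x₃))).1 - c₁‖ ≠ 0 :=
    norm_ne_zero_iff.2 (sub_ne_zero.2 fun h => hx₃not (h ▸ hc₁))
  set a := ‖(e (g (p, x₃))).1 - c₁‖ with ha
  set lam₁ := a⁻¹ • ((e (g (p, x₃))).1 - c₁) with hlam₁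
  have ha0 : 0 ≤ a := norm_nonneg _
  have hlam₁n : ‖lam₁‖ = 1 := by
    rw [hlam₁, norm_smul, norm_inv, ← ha, Real.norm_of_nonneg ha0, inv_mul_cancel₀ hn0]
  have hlam₁N : lam₁ ∈ regularNormalCone C₁ c₁ :=
    smul_sub_mem_regularNormalCone (Eventually.of_forall hc₁min) (by positivity)
  refine ⟨p, hpP, x₃, e.symm (c₁, c₂), by simpa using ⟨hc₁, hc₂⟩, e.symm (lam₁, lam₂),
    mem_regularNormalCone_preimage_prod he (by simpa using hlam₁N) (by simpa using hlam₂), a,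
    ha0, hne, by linarith, hx₃d.trans hminε, by simpa using hlam₁n, ?_, ?_, ?_, ?_, ?_⟩
  · have h1 := norm_le_add_of_inner_eq he (e.symm (lam₁, lam₂))
    rw [e.apply_symm_apply] at h1
    have h2 : 2 * ((L + σ) * κ) ≤ 2 * (((L : ℝ) + 1) * κ) := by gcongr
    simp only at h1
    linarith
  · rw [e.apply_symm_apply, e.apply_symm_apply, hlam₁, smul_inv_smul₀ hn0]
  · rw [e.apply_symm_apply]
    exact hc₂d.trans (min_le_right _ _)
  · have hder : HasFDerivAt (fun y => g (p, y)) (fderiv ℝ (fun y => g (p, y)) x₃) x₃ :=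
      ((hsm p ⟨hpP, (hloc p x₃ hpρ hx₃ρ).2.2.1⟩ x₃
        (hloc p x₃ hpρ hx₃ρ).2.1).differentiableAt one_ne_zero).hasFDerivAt
    have hder' : HasFDerivAt (fun y => e (g (p, y)))
        ((e : G →L[ℝ] G₁ × G₂) ∘L fderiv ℝ (fun y => g (p, y)) x₃) x₃ := e.hasFDerivAt.comp x₃ hder
    rw [hder'.fst.fderiv, hder'.snd.fderiv] at hstat
    have : innerSL ℝ (e.symm (lam₁, lam₂)) ∘L fderiv ℝ (fun y => g (p, y)) x₃ =
        innerSL ℝ lam₁ ∘L (ContinuousLinearMap.fst ℝ G₁ G₂ ∘L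
          ((e : G →L[ℝ] G₁ × G₂) ∘L fderiv ℝ (fun y => g (p, y)) x₃)) +
        innerSL ℝ lam₂ ∘L (ContinuousLinearMap.snd ℝ G₁ G₂ ∘L
          ((e : G →L[ℝ] G₁ × G₂) ∘L fderiv ℝ (fun y => g (p, y)) x₃)) := by
      ext v
      simp [he]
    rw [this]
    refine hstat.trans ?_
    linarith [min_le_left (2 * σ) (ε * ‖(p - p₀, x₃ - x₀)‖ ^ 2)]
  · intro y hy hyC
    refine (hopt y hy hyC).trans ?_
    gcongr
    linarith

/-! ### First- and second-order expansions. -/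

theorem HasFDerivAt.tendsto_inv_smul_sub {E G : Type*} [NormedAddCommGroup E] [NormedSpace ℝ E]
    [NormedAddCommGroup G] [NormedSpace ℝ G] {f : E → G} {f' : E →L[ℝ] G} {z : E}
    (hf : HasFDerivAt f f' z) {t : ℕ → ℝ} {v' : ℕ → E} {v : E} (htpos : ∀ k, 0 < t k)
    (ht : Tendsto t atTop (𝓝 0)) (hv : Tendsto v' atTop (𝓝 v)) :
    Tendsto (fun k => (t k)⁻¹ • (f (z + t k • v' k) - f z)) atTop (𝓝 (f' v)) := by
  refine (hasFDerivWithinAt_univ.2 hf).lim (by simpa using ht.smul hv) (by simp) ?_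
  refine hv.congr fun k => ?_
  rw [inv_smul_smul₀ (htpos k).ne']

/-- Second-order Taylor expansion with Peano remainder. -/
theorem TwiceDifferentiableAt.taylor_isLittleO {E : Type*} [NormedAddCommGroup E]
    [NormedSpace ℝ E] {f : E → ℝ} {z : E} (hf : TwiceDifferentiableAt f z) :
    (fun h => f (z + h) - f z - fderiv ℝ f z h - 1 / 2 * fderiv ℝ (fderiv ℝ f) z h h)
      =o[𝓝 0] fun h => ‖h‖ ^ 2 := by
  rw [Asymptotics.isLittleO_iff]
  intro ε hε
  have h1 : ∀ᶠ h in 𝓝 (0 : E), DifferentiableAt ℝ f (z + h) := by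
    have : Tendsto (fun h : E => z + h) (𝓝 0) (𝓝 z) := by
      simpa using (continuous_const_add z).tendsto 0
    exact this.eventually hf.1
  have h2 := (hasFDerivAt_iff_isLittleO_nhds_zero.1 hf.2.hasFDerivAt).def hε
  obtain ⟨δ, hδ, hball⟩ := Metric.eventually_nhds_iff_ball.1 (h1.and h2)
  filter_upwards [Metric.ball_mem_nhds (0 : E) hδ] with h hh
  set D := fderiv ℝ f z
  set D2 := fderiv ℝ (fderiv ℝ f) z
  have hmem : ∀ s ∈ Icc (0 : ℝ) 1, s • h ∈ Metric.ball (0 : E) δ := fun s hs => by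
    rw [mem_ball_zero_iff] at hh ⊢
    rw [norm_smul, Real.norm_of_nonneg hs.1]
    exact (mul_le_of_le_one_left (norm_nonneg _) hs.2).trans_lt hh
  -- The mean value inequality for `f` minus its quadratic model along the segment uses
  -- differentiability of the derivative at `z` only.
  have hder : ∀ s ∈ Icc (0 : ℝ) 1, HasDerivWithinAt
      (fun s : ℝ => f (z + s • h) - s * D h - s ^ 2 * (1 / 2 * D2 h h))
      ((fderiv ℝ f (z + s • h) - D - D2 (s • h)) h) (Icc (0 : ℝ) 1) s := fun s hs => by
    have e1 : HasDerivAt (fun s : ℝ => z + s • h) h s := by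
      simpa using ((hasDerivAt_id s).smul_const h).const_add z
    have e2 := (hball _ (hmem s hs)).1.hasFDerivAt.comp_hasDerivAt s e1
    have e3 := (hasDerivAt_id s).mul_const (D h)
    have e4 := (hasDerivAt_pow 2 s).mul_const (1 / 2 * D2 h h)
    refine (((e2.sub e3).sub e4).congr_deriv ?_).hasDerivWithinAt
    simp
    ring
  have key := norm_image_sub_le_of_norm_deriv_le_segment_01' hder (C := ε * ‖h‖ ^ 2)
    fun s hs => by
      refine (ContinuousLinearMap.le_opNorm _ _).trans ?_
      have e1 := (hball _ (hmem s ⟨hs.1, hs.2.le⟩)).2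
      have e2 : ‖s • h‖ ≤ ‖h‖ := by
        rw [norm_smul, Real.norm_of_nonneg hs.1]
        exact mul_le_of_le_one_left (norm_nonneg _) hs.2.le
      calc _ ≤ (ε * ‖s • h‖) * ‖h‖ := by gcongr
        _ ≤ (ε * ‖h‖) * ‖h‖ := by gcongr
        _ = ε * ‖h‖ ^ 2 := by ring
  rw [norm_pow, norm_norm]
  refine le_of_eq_of_le ?_ key
  congr 1
  simp
  ring

/-- The linear term is taken at `v' k`, not at `v`: the quotients `(v' k - v) / t k` need not
converge, and they are what the curvatures measure. -/
theorem TwiceDifferentiableAt.tendsto_second_order_quotient {E : Type*} [NormedAddCommGroup E]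
    [NormedSpace ℝ E] {f : E → ℝ} {z : E} (hf : TwiceDifferentiableAt f z) {t : ℕ → ℝ}
    {v' : ℕ → E} {v : E} (htpos : ∀ k, 0 < t k) (ht : Tendsto t atTop (𝓝 0))
    (hv : Tendsto v' atTop (𝓝 v)) :
    Tendsto (fun k => (f (z + t k • v' k) - f z - t k * fderiv ℝ f z (v' k)) / t k ^ 2) atTop
      (𝓝 (1 / 2 * fderiv ℝ (fderiv ℝ f) z v v)) := by
  set D2 := fderiv ℝ (fderiv ℝ f) z
  have hhl : Tendsto (fun k => t k • v' k) atTop (𝓝 0) := by simpa using ht.smul hv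
  have h1 := hf.taylor_isLittleO.comp_tendsto hhl
  have h2 : (fun k => ‖t k • v' k‖ ^ 2) =O[atTop] fun k => t k ^ 2 := by
    have h3 : (fun k => ‖v' k‖ ^ 2) =O[atTop] fun _ => (1 : ℝ) := (hv.norm.pow 2).isBigO_one ℝ
    have h4 := (Asymptotics.isBigO_refl (fun k => t k ^ 2) atTop).mul h3
    simp only [mul_one] at h4
    refine h4.congr_left fun k => ?_
    rw [norm_smul, Real.norm_of_nonneg (htpos k).le]
    ring
  have h3 := (h1.trans_isBigO h2).tendsto_div_nhds_zero
  have h4 : Tendsto (fun k => 1 / 2 * D2 (v' k) (v' k)) atTop (𝓝 (1 / 2 * D2 v v)) := by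
    have : Continuous fun h : E => 1 / 2 * D2 h h := by fun_prop
    exact (this.tendsto v).comp hv
  have h5 := h3.add h4
  rw [zero_add] at h5
  refine h5.congr fun k => ?_
  have := (htpos k).ne'
  simp only [Function.comp_apply, map_smul, smul_apply, smul_eq_mul]
  field_simp
  ring

theorem TwiceDifferentiableAt.inner_const {E G : Type*} [NormedAddCommGroup E] [NormedSpace ℝ E]
    [NormedAddCommGroup G] [InnerProductSpace ℝ G] {g : E → G} {z : E}
    (hg : TwiceDifferentiableAt g z) (lam : G) :
    TwiceDifferentiableAt (fun y => inner ℝ lam (g y)) z ∧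
      fderiv ℝ (fun y => inner ℝ lam (g y)) z = innerSL ℝ lam ∘L fderiv ℝ g z := by
  have hd : ∀ y, DifferentiableAt ℝ g y → HasFDerivAt (fun y => inner ℝ lam (g y))
      (innerSL ℝ lam ∘L fderiv ℝ g y) y := fun y hy => (innerSL ℝ lam).hasFDerivAt.comp y
        hy.hasFDerivAt
  have hev : (fun y => fderiv ℝ (fun y => inner ℝ lam (g y)) y) =ᶠ[𝓝 z]
      fun y => innerSL ℝ lam ∘L fderiv ℝ g y := hg.1.mono fun y hy => (hd y hy).fderiv
  refine ⟨⟨hg.1.mono fun y hy => (hd y hy).differentiableAt, ?_⟩, hev.self_of_nhds⟩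
  exact ((differentiableAt_const _).clm_comp hg.2).congr_of_eventuallyEq hev

/-! ### Curvature inequality and limits of KKT points. -/

/-- The sequences are admissible in the infimum defining one curvature and in the supremum defining
the other, so an inequality between quotients passes to the curvatures. -/
theorem lowerCurvature_le_add_upperCurvature {E G : Type*} [NormedAddCommGroup E]
    [InnerProductSpace ℝ E] [NormedAddCommGroup G] [InnerProductSpace ℝ G]
    {P : Set E} {C : Set G} {p₀ w μ : E} {c₀ v lam : G} {t s : ℕ → ℝ} {w' : ℕ → E} {v' : ℕ → G}
    {q : ℝ} (htpos : ∀ k, 0 < t k) (ht : Tendsto t atTop (𝓝 0)) (hw : Tendsto w' atTop (𝓝 w))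
    (hv : Tendsto v' atTop (𝓝 v)) (hs : Tendsto s atTop (𝓝 q)) (hP : ∀ k, p₀ + t k • w' k ∈ P)
    (hN : Tendsto (fun k => Metric.infEDist lam (limitingNormalCone C (c₀ + t k • v' k)))
      atTop (𝓝 0))
    (hle : ∀ᶠ k in atTop,
      inner ℝ lam (v' k - v) / t k ≤ s k + inner ℝ μ (w' k - w) / t k) :
    lowerCurvature C lam c₀ v ≤ (q : EReal) + upperCurvature P μ p₀ w := by
  by_contra! hlt
  -- Two real separators treat infinite curvatures uniformly; the gap `r' - r` absorbs the error in
  -- `s k → q`.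
  obtain ⟨r', hr'1, hr'2⟩ := EReal.lt_iff_exists_real_btwn.1 hlt
  obtain ⟨r, hr1, hr2⟩ := EReal.lt_iff_exists_real_btwn.1 hr'1
  have hrr : r < r' := EReal.coe_lt_coe_iff.1 hr2
  have hup : upperCurvature P μ p₀ w < ((r - q : ℝ) : EReal) := by
    rw [EReal.coe_sub, EReal.lt_sub_iff_add_lt (by simp) (by simp), add_comm]
    exact hr1
  obtain ⟨⟨ε, hε⟩, hup⟩ := iInf_lt_iff.1 hup
  obtain ⟨⟨ε₀, hε₀⟩, hlow⟩ := lt_iSup_iff.1 hr'2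
  have hε₀' : (0 : ENNReal) < ENNReal.ofReal ε₀ := ENNReal.ofReal_pos.2 hε₀
  have hwn : Tendsto (fun k => ‖w' k - w‖) atTop (𝓝 0) := tendsto_iff_norm_sub_tendsto_zero.1 hw
  have hvn : Tendsto (fun k => ‖v' k - v‖) atTop (𝓝 0) := tendsto_iff_norm_sub_tendsto_zero.1 hv
  have hsr : ∀ᶠ k in atTop, s k < q + (r' - r) := hs.eventually_lt_const (by linarith)
  obtain ⟨k, hk1, hk2, hk3, hk4, hk5, hk6, hk7⟩ := ((ht.eventually_lt_const hε).and
    ((ht.eventually_lt_const hε₀).and ((hwn.eventually_lt_const hε).and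
      ((hvn.eventually_lt_const hε₀).and ((hN.eventually_lt_const hε₀').and
        (hsr.and hle)))))).exists
  have h1 : ((inner ℝ μ (w' k - w) / t k : ℝ) : EReal) < ((r - q : ℝ) : EReal) := by
    refine lt_of_le_of_lt (le_sSup ?_) hup
    exact ⟨t k, w' k, htpos k, hk1, hk3, hP k, rfl⟩
  have h2 : (r' : EReal) < ((inner ℝ lam (v' k - v) / t k : ℝ) : EReal) := by
    refine lt_of_lt_of_le hlow (sInf_le ?_)
    exact ⟨t k, v' k, htpos k, hk2, hk4, hk5, rfl⟩
  rw [EReal.coe_lt_coe_iff] at h1 h2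
  linarith

section SecondOrder

variable {E F G G₁ G₂ : Type*} [NormedAddCommGroup G] [InnerProductSpace ℝ G]
  [NormedAddCommGroup G₁] [InnerProductSpace ℝ G₁] [NormedAddCommGroup G₂] [InnerProductSpace ℝ G₂]
  {e : G ≃L[ℝ] G₁ × G₂} {C₁ : Set G₁} {C₂ : Set G₂}

/-- Along approximate minimizers of the residual of the first subsystem subject to the second one,
the residual is of smaller order than the distance to the reference point. -/
theorem tendsto_residual_div [NormedAddCommGroup E] [NormedSpace ℝ E]
    [NormedAddCommGroup F] [NormedSpace ℝ F] {P : Set E} {g : E × F → G} {g' : E × F →L[ℝ] G}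
    {p₀ : E} {x₀ : F} (he : ∀ x y, inner ℝ x y = inner ℝ (e x).1 (e y).1 + inner ℝ (e x).2 (e y).2)
    (hfeas : g (p₀, x₀) ∈ e ⁻¹' (C₁ ×ˢ C₂)) (hdiff : HasStrictFDerivAt g g' (p₀, x₀))
    (hsub : RobinsonStable P (fun z => (e (g z)).2) C₂ p₀ x₀)
    {t a ε : ℕ → ℝ} {w' : ℕ → E} {u' : ℕ → F} {w : E} {u v : F} {r : ℝ} (hr : 0 < r)
    (htpos : ∀ k, 0 < t k) (ht : Tendsto t atTop (𝓝 0)) (hw : Tendsto w' atTop (𝓝 w))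
    (hu : Tendsto u' atTop (𝓝 u)) (hε : Tendsto ε atTop (𝓝 0)) (hε0 : ∀ k, 0 ≤ ε k)
    (ha : ∀ k, 0 ≤ a k) (hP : ∀ k, p₀ + t k • w' k ∈ P)
    (hv : Tendsto (fun k => Metric.infDist (g (p₀, x₀) + t k • g' (w, v)) (e ⁻¹' (C₁ ×ˢ C₂)) / t k)
      atTop (𝓝 0))
    (hmin : ∀ k, ∀ x', ‖x' - x₀‖ ≤ r → (e (g (p₀ + t k • w' k, x'))).2 ∈ C₂ →
      a k ≤ Metric.infDist (e (g (p₀ + t k • w' k, x'))).1 C₁ +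
        ε k * ‖x' - (x₀ + t k • u' k)‖) :
    Tendsto (fun k => a k / t k) atTop (𝓝 0) := by
  have hneC : (e ⁻¹' (C₁ ×ˢ C₂)).Nonempty := ⟨_, hfeas⟩
  obtain ⟨L, s, hs, hLip⟩ := hdiff.exists_lipschitzOnWith
  obtain ⟨κ, ρ, hρ, hκ⟩ := hsub.exists_solution ⟨_, hfeas.2⟩
  -- Competitors follow the direction `v` from tangential solvability, which need not be `u`; their
  -- residual is `o(t)`, and the price `ε k * ‖x' - x‖` is also `o(t)`.
  set y : ℕ → F := fun k => x₀ + t k • v with hy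
  set p : ℕ → E := fun k => p₀ + t k • w' k with hp
  set d : ℕ → ℝ := fun k => Metric.infDist (g (p k, y k)) (e ⁻¹' (C₁ ×ˢ C₂)) / t k with hd
  have hpl : Tendsto p atTop (𝓝 p₀) := by simpa using (ht.smul hw).const_add p₀
  have hyl : Tendsto y atTop (𝓝 x₀) := by simpa using (ht.smul_const v).const_add x₀
  have hquot := hdiff.hasFDerivAt.tendsto_inv_smul_sub htpos ht
    (hw.prodMk_nhds (tendsto_const_nhds (x := v)))
  have hd0 : Tendsto d atTop (𝓝 0) := by
    have hbound : ∀ k, d k ≤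
        Metric.infDist (g (p₀, x₀) + t k • g' (w, v)) (e ⁻¹' (C₁ ×ˢ C₂)) / t k +
        ‖(t k)⁻¹ • (g ((p₀, x₀) + t k • (w' k, v)) - g (p₀, x₀)) - g' (w, v)‖ := fun k => by
      have h1 := Metric.infDist_le_infDist_add_dist (s := e ⁻¹' (C₁ ×ˢ C₂)) (x := g (p k, y k))
        (y := g (p₀, x₀) + t k • g' (w, v))
      have h2 : dist (g (p k, y k)) (g (p₀, x₀) + t k • g' (w, v)) =
          t k * ‖(t k)⁻¹ • (g ((p₀, x₀) + t k • (w' k, v)) - g (p₀, x₀)) - g' (w, v)‖ := by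
        rw [← Real.norm_of_nonneg (htpos k).le, ← norm_smul, smul_sub, Real.norm_of_nonneg
          (htpos k).le, smul_inv_smul₀ (htpos k).ne', dist_eq_norm, sub_sub]
        rfl
      rw [h2] at h1
      rw [hd]
      simp only
      rw [div_le_iff₀ (htpos k), add_mul, div_mul_cancel₀ _ (htpos k).ne']
      linarith
    refine squeeze_zero (fun k => div_nonneg Metric.infDist_nonneg (htpos k).le) hbound ?_
    simpa using hv.add (tendsto_iff_norm_sub_tendsto_zero.1 hquot)
  have hd_nonneg : ∀ k, 0 ≤ d k := fun k => div_nonneg Metric.infDist_nonneg (htpos k).le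
  have hb0 : Tendsto (fun k => κ * d k + t k) atTop (𝓝 0) := by
    simpa using (hd0.const_mul (κ : ℝ)).add ht
  have hgoal : Tendsto (fun k => d k + L * (κ * d k + t k) + ε k * ((κ * d k + t k) + ‖v - u' k‖))
      atTop (𝓝 0) := by
    have h1 := (hd0.add (hb0.const_mul (L : ℝ))).add (hε.mul (hb0.add (hu.const_sub v).norm))
    simpa using h1
  refine squeeze_zero' (Eventually.of_forall fun k => div_nonneg (ha k) (htpos k).le) ?_ hgoal
  obtain ⟨δ, hδ, hδs⟩ := Metric.mem_nhds_iff.1 hs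
  have hmem : ∀ p x, ‖p - p₀‖ < δ → ‖x - x₀‖ < δ → (p, x) ∈ s := fun p x h1 h2 => hδs (by
    rw [mem_ball_iff_norm, Prod.norm_def]; exact max_lt h1 h2)
  have hpn : Tendsto (fun k => ‖p k - p₀‖) atTop (𝓝 0) := tendsto_iff_norm_sub_tendsto_zero.1 hpl
  have hyn : Tendsto (fun k => ‖y k - x₀‖) atTop (𝓝 0) := tendsto_iff_norm_sub_tendsto_zero.1 hyl
  have hxn : Tendsto (fun k => t k * (κ * d k + t k) + ‖y k - x₀‖) atTop (𝓝 0) := by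
    simpa using (ht.mul hb0).add hyn
  filter_upwards [hpn.eventually_lt_const (lt_min hρ hδ), hyn.eventually_lt_const (lt_min hρ hδ),
    hxn.eventually_lt_const (lt_min hr hδ)] with k hk1 hk2 hk3
  rw [lt_min_iff] at hk1 hk2 hk3
  have htd : Metric.infDist (g (p k, y k)) (e ⁻¹' (C₁ ×ˢ C₂)) = t k * d k :=
    (mul_div_cancel₀ _ (htpos k).ne').symm
  -- The added `t k * t k` makes the inequality strict even when the residual vanishes.
  obtain ⟨x', hx'C, hx'd⟩ := hκ (p k) (hP k) hk1.1 (y k) hk2.1 (t k * (κ * d k + t k)) (by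
    have h1 := infDist_snd_le_of_inner_eq he hneC (g (p k, y k))
    rw [htd] at h1
    have h2 := mul_le_mul_of_nonneg_left h1 κ.coe_nonneg
    have h3 := mul_pos (htpos k) (htpos k)
    calc _ ≤ _ := h2
      _ < _ := by linarith)
  have hx'0 : ‖x' - x₀‖ ≤ t k * (κ * d k + t k) + ‖y k - x₀‖ := by
    have := norm_sub_le_norm_sub_add_norm_sub x' (y k) x₀
    rw [norm_sub_rev x' (y k)] at this
    linarith
  have h1 := hmin k x' (by linarith [hk3.1]) hx'C
  have h2 : Metric.infDist (e (g (p k, x'))).1 C₁ ≤ t k * d k + L * (t k * (κ * d k + t k)) := by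
    have e1 := Metric.infDist_le_infDist_add_dist (s := e ⁻¹' (C₁ ×ˢ C₂)) (x := g (p k, x'))
      (y := g (p k, y k))
    have e2 := hLip.dist_le_mul _ (hmem (p k) x' hk1.2 (by linarith [hk3.2])) _
      (hmem (p k) (y k) hk1.2 hk2.2)
    rw [dist_eq_norm (p k, x'), Prod.mk_sub_mk, sub_self, Prod.norm_mk, norm_zero,
      max_eq_right (norm_nonneg _), norm_sub_rev x'] at e2
    have e3 := mul_le_mul_of_nonneg_left hx'd.le L.coe_nonneg
    have e4 := infDist_fst_le_of_inner_eq he hneC (g (p k, x'))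
    rw [htd] at e1
    linarith
  have h3 : ‖x' - (x₀ + t k • u' k)‖ ≤ t k * (κ * d k + t k) + t k * ‖v - u' k‖ := by
    have e1 := norm_sub_le_norm_sub_add_norm_sub x' (y k) (x₀ + t k • u' k)
    have e2 : y k - (x₀ + t k • u' k) = t k • (v - u' k) := by
      rw [hy, smul_sub]; simp only; abel
    rw [e2, norm_smul, Real.norm_of_nonneg (htpos k).le, norm_sub_rev x' (y k)] at e1
    linarith
  have h4 := mul_le_mul_of_nonneg_left h3 (hε0 k)
  rw [div_le_iff₀ (htpos k)]
  calc a k ≤ t k * d k + L * (t k * (κ * d k + t k)) +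
        ε k * (t k * (κ * d k + t k) + t k * ‖v - u' k‖) := h1.trans (add_le_add h2 h4)
    _ = _ := by ring

/-- Limits of approximate KKT points satisfy the second-order curvature inequality. -/
theorem curvature_le_of_approximate_kkt [NormedAddCommGroup E] [InnerProductSpace ℝ E]
    [CompleteSpace E] [CompleteSpace G]
    [NormedAddCommGroup F] [NormedSpace ℝ F] {P : Set E} {g : E × F → G}
    {p₀ : E} {x₀ : F} (he : ∀ x y, inner ℝ x y = inner ℝ (e x).1 (e y).1 + inner ℝ (e x).2 (e y).2)
    (hdiff : TwiceDifferentiableAt g (p₀, x₀))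
    {t a ε : ℕ → ℝ} {w' : ℕ → E} {u' : ℕ → F} {z c lam' : ℕ → G} {w : E} {u : F} {lam : G}
    (htpos : ∀ k, 0 < t k) (ht : Tendsto t atTop (𝓝 0)) (hw : Tendsto w' atTop (𝓝 w))
    (hu : Tendsto u' atTop (𝓝 u)) (hlam : Tendsto lam' atTop (𝓝 lam))
    (hε : Tendsto ε atTop (𝓝 0)) (ha : ∀ k, 0 ≤ a k)
    (hat : Tendsto (fun k => a k / t k) atTop (𝓝 0)) (hP : ∀ k, p₀ + t k • w' k ∈ P)
    (hc : ∀ k, c k ∈ e ⁻¹' (C₁ ×ˢ C₂))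
    (hN : ∀ k, lam' k ∈ regularNormalCone (e ⁻¹' (C₁ ×ˢ C₂)) (c k))
    (hlam1 : ∀ k, ‖(e (lam' k)).1‖ = 1) (hz : ∀ k, z k = g ((p₀, x₀) + t k • (w' k, u' k)))
    (hfst : ∀ k, (e (z k)).1 - (e (c k)).1 = a k • (e (lam' k)).1)
    (hsnd : ∀ k, ‖(e (c k)).2 - (e (z k)).2‖ ≤ ε k * t k ^ 2)
    (hker : ∀ v, inner ℝ lam (fderiv ℝ g (p₀, x₀) (0, v)) = 0) :
    fderiv ℝ g (p₀, x₀) (w, u) ∈ contingentCone (e ⁻¹' (C₁ ×ˢ C₂)) (g (p₀, x₀)) ∧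
    lam ∈ directionalNormalCone (e ⁻¹' (C₁ ×ˢ C₂)) (g (p₀, x₀)) (fderiv ℝ g (p₀, x₀) (w, u)) ∧
    lowerCurvature (e ⁻¹' (C₁ ×ˢ C₂)) lam (g (p₀, x₀)) (fderiv ℝ g (p₀, x₀) (w, u)) ≤
      ((1 / 2 * fderiv ℝ (fderiv ℝ (fun z => inner ℝ lam (g z))) (p₀, x₀)
        (w, u) (w, u) : ℝ) : EReal) +
      upperCurvature P (ContinuousLinearMap.adjoint
        (fderiv ℝ (fun p => g (p, x₀)) p₀) lam) p₀ w := by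
  have hderiv : HasFDerivAt g (fderiv ℝ g (p₀, x₀)) (p₀, x₀) := hdiff.1.self_of_nhds.hasFDerivAt
  obtain ⟨hf2, hf1⟩ := hdiff.inner_const lam
  have hζ : Tendsto (fun k => (w' k, u' k)) atTop (𝓝 (w, u)) := hw.prodMk_nhds hu
  have hslim := hf2.tendsto_second_order_quotient htpos ht hζ
  rw [hf1] at hslim
  generalize fderiv ℝ g (p₀, x₀) = g' at *
  have hquot : Tendsto (fun k => (t k)⁻¹ • (z k - g (p₀, x₀))) atTop (𝓝 (g' (w, u))) := by
    simpa only [hz] using hderiv.tendsto_inv_smul_sub htpos ht hζ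
  have hcz : Tendsto (fun k => (t k)⁻¹ • (c k - z k)) atTop (𝓝 0) := by
    refine squeeze_zero_norm (a := fun k => a k / t k + ε k * t k) (fun k => ?_)
      (by simpa using hat.add (hε.mul ht))
    have h1 := norm_le_add_of_inner_eq he (c k - z k)
    rw [map_sub, Prod.fst_sub, Prod.snd_sub, norm_sub_rev (e (c k)).1, hfst k, norm_smul, hlam1 k,
      mul_one, Real.norm_of_nonneg (ha k)] at h1
    have h2 := htpos k
    rw [norm_smul, norm_inv, Real.norm_of_nonneg h2.le, inv_mul_le_iff₀ h2]
    calc _ ≤ a k + ε k * t k ^ 2 := h1.trans (add_le_add_right (hsnd k) _)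
      _ = t k * (a k / t k + ε k * t k) := by field_simp
  obtain ⟨v', hv'⟩ : ∃ v' : ℕ → G, ∀ k, v' k = (t k)⁻¹ • (c k - g (p₀, x₀)) := ⟨_, fun _ => rfl⟩
  have hv : Tendsto v' atTop (𝓝 (g' (w, u))) := by
    have h1 := hcz.add hquot
    rw [zero_add] at h1
    refine h1.congr fun k => ?_
    rw [← smul_add, sub_add_sub_cancel, hv']
  have hcv : ∀ k, g (p₀, x₀) + t k • v' k = c k := fun k => by
    rw [hv', smul_inv_smul₀ (htpos k).ne', add_sub_cancel]
  refine ⟨⟨t, v', htpos, ht, hv, fun k => by rw [hcv]; exact hc k⟩,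
    ⟨t, v', lam', htpos, ht, hv, hlam, fun k => by rw [hcv]; exact ⟨hc k, hN k⟩⟩, ?_⟩
  have hpart : HasFDerivAt (fun p => g (p, x₀)) (g' ∘L ContinuousLinearMap.inl ℝ E F) p₀ :=
    HasFDerivAt.comp p₀ (f := fun p => (p, x₀)) hderiv (hasFDerivAt_prodMk_left p₀ x₀)
  have hslim' := (hε.const_mul ‖lam‖).add hslim
  rw [mul_zero, zero_add] at hslim'
  refine lowerCurvature_le_add_upperCurvature htpos ht hw hv hslim' hP ?_ ?_
  · have h1 : Tendsto (fun k => edist lam (lam' k)) atTop (𝓝 0) := by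
      simpa only [edist_self] using (tendsto_const_nhds (x := lam)).edist hlam
    refine tendsto_of_tendsto_of_tendsto_of_le_of_le tendsto_const_nhds h1 (fun _ => zero_le)
      fun k => Metric.infEDist_le_edist_of_mem ?_
    rw [hcv]
    exact ⟨hc k, fun _ => c k, fun _ => lam' k, tendsto_const_nhds, tendsto_const_nhds,
      fun _ => ⟨hc k, hN k⟩⟩
  · have hone : Tendsto (fun k => inner ℝ (e lam).1 (e (lam' k)).1) atTop (𝓝 1) := by
      have h1 : Tendsto (fun k => (e (lam' k)).1) atTop (𝓝 (e lam).1) :=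
        (continuous_fst.tendsto _).comp ((e.continuous.tendsto lam).comp hlam)
      have h2 : ‖(e lam).1‖ = 1 := by
        have h3 := h1.norm
        simp only [hlam1] at h3
        exact (tendsto_nhds_unique h3 tendsto_const_nhds)
      have h4 := (tendsto_const_nhds (x := (e lam).1)).inner h1 (𝕜 := ℝ)
      rwa [real_inner_self_eq_norm_sq, h2, one_pow] at h4
    filter_upwards [hone.eventually_const_lt one_pos] with k hk
    have htk := htpos k
    -- The contribution of the first component is `-a k * ⟨λ¹, λ¹ₖ⟩`, nonpositive once the inner
    -- product is near `1`, so no second-order bound on `a k` is needed.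
    have h1 : inner ℝ lam (c k - z k) ≤ ‖lam‖ * (ε k * t k ^ 2) := by
      rw [he, map_sub, Prod.fst_sub, Prod.snd_sub, ← neg_sub (e (z k)).1, hfst k, inner_neg_right,
        inner_smul_right]
      have e1 := mul_nonneg (ha k) hk.le
      have e2 := (real_inner_le_norm (e lam).2 ((e (c k)).2 - (e (z k)).2)).trans
        (mul_le_mul (norm_snd_le_of_inner_eq he lam) (hsnd k) (norm_nonneg _) (norm_nonneg _))
      linarith
    -- The increment `u' k - u` drops out by stationarity in `x`, leaving only the parameter
    -- increment.
    have h3 : inner ℝ (ContinuousLinearMap.adjoint (fderiv ℝ (fun p => g (p, x₀)) p₀) lam)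
        (w' k - w) = inner ℝ lam (g' (w' k, u' k)) - inner ℝ lam (g' (w, u)) := by
      rw [ContinuousLinearMap.adjoint_inner_left, hpart.fderiv, ← inner_sub_right, ← map_sub]
      have e1 : (w' k, u' k) - (w, u) = (w' k - w, 0) + (0, u' k - u) := by simp
      rw [e1, map_add, inner_add_right, hker, add_zero]
      rfl
    have h4 : inner ℝ lam (v' k - g' (w, u)) = (t k)⁻¹ * (inner ℝ lam (c k - z k) +
        inner ℝ lam (z k - g (p₀, x₀))) - inner ℝ lam (g' (w, u)) := by
      rw [inner_sub_right, ← inner_add_right, sub_add_sub_cancel, hv', inner_smul_right]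
    have h5 : (t k)⁻¹ * inner ℝ lam (c k - z k) ≤ ‖lam‖ * ε k * t k := by
      rw [inv_mul_le_iff₀ htk]
      linarith
    rw [h3, h4, div_le_iff₀ htk, ← hz, ← inner_sub_right, ContinuousLinearMap.comp_apply,
      innerSL_apply_apply]
    generalize inner ℝ lam (z k - g (p₀, x₀)) = A at *
    generalize inner ℝ lam (g' (w' k, u' k)) = B at *
    have h6 : (‖lam‖ * ε k + (A - t k * B) / t k ^ 2 + (B - inner ℝ lam (g' (w, u))) / t k) * t k =
        ‖lam‖ * ε k * t k + (t k)⁻¹ * A - inner ℝ lam (g' (w, u)) := by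
      field_simp
      ring
    rw [h6, mul_add]
    linarith

end SecondOrder

/-! ### Extraction of limits and the theorem. -/

/-- The bound `hb` matters: for a real sequence tending to infinity, `liminf` takes the default
value `0`. -/
theorem exists_subseq_tendsto_of_liminf_eq_zero {f : ℕ → ℝ} {b : ℝ} (h0 : ∀ k, 0 ≤ f k)
    (hb : ∀ k, f k ≤ b) (hf : liminf f atTop = 0) :
    ∃ ψ : ℕ → ℕ, StrictMono ψ ∧ Tendsto (fun k => f (ψ k)) atTop (𝓝 0) := by
  have hcob : IsCoboundedUnder (· ≥ ·) atTop f :=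
    (isBoundedUnder_of ⟨b, hb⟩ : IsBoundedUnder (· ≤ ·) atTop f).isCoboundedUnder_ge
  obtain ⟨ψ, hψ, hlt⟩ := extraction_forall_of_frequently
    (P := fun n k => f k < 1 / ((n : ℝ) + 1)) fun n =>
      frequently_lt_of_liminf_lt hcob (by rw [hf]; positivity)
  exact ⟨ψ, hψ, squeeze_zero (fun k => h0 _) (fun k => (hlt k).le)
    tendsto_one_div_add_atTop_nhds_zero_nat⟩

/-- The second-order condition for Robinson stability of a system split into two subsystems, the
second of which is Robinson stable. The splitting of the image space is an orthogonal
decomposition `e : G ≃L[ℝ] G₁ × G₂`. -/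
theorem robinsonStable_of_second_order {E F G G₁ G₂ : Type*}
    [NormedAddCommGroup E] [InnerProductSpace ℝ E] [ProperSpace E]
    [NormedAddCommGroup F] [InnerProductSpace ℝ F] [ProperSpace F]
    [NormedAddCommGroup G] [InnerProductSpace ℝ G] [ProperSpace G]
    [NormedAddCommGroup G₁] [InnerProductSpace ℝ G₁] [ProperSpace G₁]
    [NormedAddCommGroup G₂] [InnerProductSpace ℝ G₂] [ProperSpace G₂]
    {e : G ≃L[ℝ] G₁ × G₂}
    (he : ∀ x y, inner ℝ x y = inner ℝ (e x).1 (e y).1 + inner ℝ (e x).2 (e y).2)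
    {P : Set E} {g : E × F → G} {C₁ : Set G₁} {C₂ : Set G₂} {p₀ : E} {x₀ : F}
    (hfeas : g (p₀, x₀) ∈ e ⁻¹' (C₁ ×ˢ C₂))
    (hC₁ : LocallyClosedAround C₁ (e (g (p₀, x₀))).1)
    (hC₂ : LocallyClosedAround C₂ (e (g (p₀, x₀))).2)
    (hsmooth : SmoothInDecision P g p₀ x₀)
    (hdiff : TwiceDifferentiableAt g (p₀, x₀))
    (htan : ∀ w ∈ contingentCone P p₀, ∀ τ : ℕ → ℝ, (∀ k, 0 < τ k) →
      Tendsto τ atTop (𝓝 0) → ∃ u : F, liminf (fun k => Metric.infDist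
          (g (p₀, x₀) + τ k • fderiv ℝ g (p₀, x₀) (w, u)) (e ⁻¹' (C₁ ×ˢ C₂)) / τ k) atTop = 0)
    (hsub : RobinsonStable P (fun z => (e (g z)).2) C₂ p₀ x₀)
    (hsecond : ∀ (w : E) (u : F) (lam : G), (w, u) ≠ (0, 0) → w ∈ contingentCone P p₀ →
      fderiv ℝ g (p₀, x₀) (w, u) ∈ contingentCone (e ⁻¹' (C₁ ×ˢ C₂)) (g (p₀, x₀)) →
      lam ∈ directionalNormalCone (e ⁻¹' (C₁ ×ˢ C₂)) (g (p₀, x₀))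
        (fderiv ℝ g (p₀, x₀) (w, u)) →
      ContinuousLinearMap.adjoint (fderiv ℝ (fun x => g (p₀, x)) x₀) lam = 0 →
      lowerCurvature (e ⁻¹' (C₁ ×ˢ C₂)) lam (g (p₀, x₀)) (fderiv ℝ g (p₀, x₀) (w, u)) ≤
        ((1 / 2 * fderiv ℝ (fderiv ℝ (fun z => inner ℝ lam (g z))) (p₀, x₀)
            (w, u) (w, u) : ℝ) : EReal) +
          upperCurvature P (ContinuousLinearMap.adjoint
            (fderiv ℝ (fun p => g (p, x₀)) p₀) lam) p₀ w →
      (e lam).1 = 0) :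
    RobinsonStable P g (e ⁻¹' (C₁ ×ˢ C₂)) p₀ x₀ := by
  by_contra hnot
  have hstrict := hdiff.hasStrictFDerivAt
  obtain ⟨K, r, hr, H⟩ := exists_approximate_kkt_of_not_robinsonStable he hfeas hC₁ hC₂
    hsmooth.1 hstrict hsub hnot
  set ε : ℕ → ℝ := fun k => 1 / ((k : ℝ) + 1) with hεdef
  have hεpos : ∀ k, 0 < ε k := fun k => by positivity
  have hε : Tendsto ε atTop (𝓝 0) := tendsto_one_div_add_atTop_nhds_zero_nat
  choose p hpP x c hc lam' hN a ha hne hpε hxε hlam1 hlamK hfst hsnd hstat hmin using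
    fun k => H (ε k) (hεpos k)
  set t : ℕ → ℝ := fun k => ‖(p k - p₀, x k - x₀)‖ with htdef
  have htpos : ∀ k, 0 < t k := fun k => norm_pos_iff.2 (hne k)
  -- The product `E × F` has the sup norm, so no constant appears.
  have htε : ∀ k, t k ≤ ε k := fun k => by
    rw [htdef]
    exact max_le (hpε k) (hxε k)
  have ht : Tendsto t atTop (𝓝 0) := squeeze_zero (fun k => (htpos k).le) htε hε
  set ζ : ℕ → E × F := fun k => (t k)⁻¹ • (p k - p₀, x k - x₀) with hζdef
  have hζn : ∀ k, ‖ζ k‖ = 1 := fun k => by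
    rw [hζdef]
    simp only
    rw [norm_smul, norm_inv, Real.norm_of_nonneg (htpos k).le, inv_mul_cancel₀ (htpos k).ne']
  have hp : ∀ k, p₀ + t k • (ζ k).1 = p k := fun k => by
    rw [hζdef]
    simp only
    rw [Prod.smul_fst, smul_inv_smul₀ (htpos k).ne', add_sub_cancel]
  have hx : ∀ k, x₀ + t k • (ζ k).2 = x k := fun k => by
    rw [hζdef]
    simp only
    rw [Prod.smul_snd, smul_inv_smul₀ (htpos k).ne', add_sub_cancel]
  obtain ⟨⟨⟨w, u⟩, lam⟩, -, φ, hφ, hlim⟩ :=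
    ((isCompact_closedBall (0 : E × F) 1).prod (isCompact_closedBall (0 : G) K)).tendsto_subseq
      (x := fun k => (ζ k, lam' k)) fun k =>
        ⟨by simpa using (hζn k).le, by simpa using hlamK k⟩
  have hζφ : Tendsto (fun k => ζ (φ k)) atTop (𝓝 (w, u)) := (continuous_fst.tendsto _).comp hlim
  have hlamφ : Tendsto (fun k => lam' (φ k)) atTop (𝓝 lam) := (continuous_snd.tendsto _).comp hlim
  have hwu : (w, u) ≠ (0, 0) := by
    have h1 := hζφ.norm
    simp only [hζn] at h1
    have h2 := tendsto_nhds_unique h1 tendsto_const_nhds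
    intro h
    rw [h, Prod.mk_zero_zero, norm_zero] at h2
    exact zero_ne_one h2
  have hwφ : Tendsto (fun k => (ζ (φ k)).1) atTop (𝓝 w) := (continuous_fst.tendsto _).comp hζφ
  have htφ : Tendsto (fun k => t (φ k)) atTop (𝓝 0) := ht.comp hφ.tendsto_atTop
  have hwP : w ∈ contingentCone P p₀ :=
    ⟨fun k => t (φ k), fun k => (ζ (φ k)).1, fun k => htpos _, htφ, hwφ, fun k => by
      rw [hp]; exact hpP _⟩
  obtain ⟨v, hv⟩ := htan w hwP (fun k => t (φ k)) (fun k => htpos _) htφ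
  obtain ⟨ψ, hψ, hvψ⟩ := exists_subseq_tendsto_of_liminf_eq_zero
    (b := ‖fderiv ℝ g (p₀, x₀) (w, v)‖)
    (fun k => div_nonneg Metric.infDist_nonneg (htpos _).le) (fun k => by
      rw [div_le_iff₀ (htpos _)]
      refine (Metric.infDist_le_dist_of_mem hfeas).trans_eq ?_
      rw [dist_eq_norm, add_sub_cancel_left, norm_smul, Real.norm_of_nonneg (htpos _).le,
        mul_comm]) hv
  obtain ⟨θ, hθdef⟩ : ∃ θ : ℕ → ℕ, ∀ k, θ k = φ (ψ k) := ⟨_, fun _ => rfl⟩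
  simp only [← hθdef] at hvψ
  have hψt := hψ.tendsto_atTop
  have hθ : Tendsto θ atTop atTop :=
    (hφ.tendsto_atTop.comp hψt).congr fun k => (hθdef k).symm
  have hζθ : Tendsto (fun k => ζ (θ k)) atTop (𝓝 (w, u)) :=
    (hζφ.comp hψt).congr fun k => by rw [hθdef]; rfl
  have hlamθ : Tendsto (fun k => lam' (θ k)) atTop (𝓝 lam) :=
    (hlamφ.comp hψt).congr fun k => by rw [hθdef]; rfl
  have hwθ : Tendsto (fun k => (ζ (θ k)).1) atTop (𝓝 w) := (continuous_fst.tendsto _).comp hζθ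
  have huθ : Tendsto (fun k => (ζ (θ k)).2) atTop (𝓝 u) := (continuous_snd.tendsto _).comp hζθ
  have htθ : Tendsto (fun k => t (θ k)) atTop (𝓝 0) := ht.comp hθ
  have hεθ : Tendsto (fun k => ε (θ k)) atTop (𝓝 0) := hε.comp hθ
  have haθ : Tendsto (fun k => a (θ k) / t (θ k)) atTop (𝓝 0) :=
    tendsto_residual_div he hfeas hstrict hsub hr (fun k => htpos _) htθ hwθ huθ hεθ
      (fun k => (hεpos _).le) (fun k => ha _) (fun k => by rw [hp]; exact hpP _) hvψ
      (fun k x' h1 h2 => by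
        rw [hp] at h2 ⊢
        rw [hx]
        exact hmin _ x' h1 h2)
  have hpxθ : Tendsto (fun k => (p (θ k), x (θ k))) atTop (𝓝 (p₀, x₀)) := by
    have h1 : Tendsto (fun k => (p₀, x₀) + t (θ k) • ζ (θ k)) atTop (𝓝 (p₀, x₀)) := by
      simpa using (htθ.smul hζθ).const_add (p₀, x₀)
    refine h1.congr fun k => ?_
    rw [← hp, ← hx]
    rfl
  -- Approximate stationarity passes to the limit because the full derivative of `g` is continuous
  -- at the reference pair.
  have hker : ∀ y, inner ℝ lam (fderiv ℝ g (p₀, x₀) (0, y)) = 0 := fun y => by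
    have h0 : Tendsto (fun k => fderiv ℝ g (p (θ k), x (θ k))) atTop
        (𝓝 (fderiv ℝ g (p₀, x₀))) := hdiff.2.continuousAt.tendsto.comp hpxθ
    have h1 : Tendsto (fun k => inner ℝ (lam' (θ k)) (fderiv ℝ g (p (θ k), x (θ k)) (0, y))) atTop
        (𝓝 (inner ℝ lam (fderiv ℝ g (p₀, x₀) (0, y)))) :=
      hlamθ.inner (((ContinuousLinearMap.apply ℝ G ((0 : E), y)).continuous.tendsto _).comp h0)
    refine tendsto_nhds_unique h1 (squeeze_zero_norm' ?_
      (by simpa using hεθ.mul_const ‖y‖ : Tendsto (fun k => ε (θ k) * ‖y‖) atTop (𝓝 0)))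
    filter_upwards [hpxθ.eventually hdiff.1] with k hk
    have h2 : HasFDerivAt (fun y => g (p (θ k), y))
        (fderiv ℝ g (p (θ k), x (θ k)) ∘L ContinuousLinearMap.inr ℝ E F) (x (θ k)) :=
      HasFDerivAt.comp _ (f := fun y => (p (θ k), y)) hk.hasFDerivAt
        (hasFDerivAt_prodMk_right _ _)
    have h3 := ContinuousLinearMap.le_of_opNorm_le _ (hstat (θ k)) y
    rw [h2.fderiv] at h3
    exact h3
  obtain ⟨hT, hD, hcurv⟩ := curvature_le_of_approximate_kkt (P := P) he hdiff (fun k => htpos (θ k))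
    htθ hwθ huθ hlamθ hεθ (fun k => ha _) haθ (fun k => by rw [hp]; exact hpP _)
    (fun k => hc (θ k)) (fun k => hN _) (fun k => hlam1 _)
    (z := fun k => g (p (θ k), x (θ k))) (fun k => by rw [← hp, ← hx]; rfl)
    (fun k => hfst _) (fun k => hsnd _) hker
  have hadj : ContinuousLinearMap.adjoint (fderiv ℝ (fun x => g (p₀, x)) x₀) lam = 0 := by
    refine ext_inner_right ℝ fun y => ?_
    have h2 : HasFDerivAt (fun y => g (p₀, y))
        (fderiv ℝ g (p₀, x₀) ∘L ContinuousLinearMap.inr ℝ E F) x₀ :=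
      HasFDerivAt.comp _ (f := fun y => (p₀, y)) hstrict.hasFDerivAt (hasFDerivAt_prodMk_right _ _)
    rw [ContinuousLinearMap.adjoint_inner_left, h2.fderiv, inner_zero_left]
    exact hker y
  have hzero := hsecond w u lam hwu hwP hT hD hadj hcurv
  have h1 : Tendsto (fun k => ‖(e (lam' (θ k))).1‖) atTop (𝓝 ‖(e lam).1‖) :=
    ((continuous_fst.tendsto _).comp ((e.continuous.tendsto lam).comp hlamθ)).norm
  simp only [hlam1, hzero, norm_zero] at h1
  exact one_ne_zero (tendsto_nhds_unique tendsto_const_nhds h1)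

theorem theorem4p3 {m n l₁ l₂ : ℕ}
    (P : Set (EuclideanSpace ℝ (Fin m)))
    (g : EuclideanSpace ℝ (Fin m) × EuclideanSpace ℝ (Fin n) → SplitSpace l₁ l₂)
    (C₁ : Set (EuclideanSpace ℝ (Fin l₁))) (C₂ : Set (EuclideanSpace ℝ (Fin l₂)))
    (pbar : EuclideanSpace ℝ (Fin m)) (xbar : EuclideanSpace ℝ (Fin n))
    -- the reference feasible pair
    (hp : pbar ∈ P) (hfeas : g (pbar, xbar) ∈ splitSet C₁ C₂)
    (hC₁ : LocallyClosedAround C₁ (g (pbar, xbar)).fst)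
    (hC₂ : LocallyClosedAround C₂ (g (pbar, xbar)).snd)
    (hsmooth : SmoothInDecision P g pbar xbar)
    (hdiff : TwiceDifferentiableAt g (pbar, xbar))
    -- existence of tangent directions
    (htan : ∀ w ∈ contingentCone P pbar, ∀ τ : ℕ → ℝ, (∀ k, 0 < τ k) →
      Tendsto τ atTop (𝓝 0) → ∃ u : EuclideanSpace ℝ (Fin n),
        liminf (fun k => Metric.infDist
          (g (pbar, xbar) + τ k • fderiv ℝ g (pbar, xbar) (w, u)) (splitSet C₁ C₂) / τ k)
          atTop = 0)
    -- Robinson stability of the subsystem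
    (hsub : RobinsonStable P (fun z => (g z).snd) C₂ pbar xbar)
    -- the second-order condition
    (hsecond : ∀ (w : EuclideanSpace ℝ (Fin m)) (u : EuclideanSpace ℝ (Fin n))
      (lam : SplitSpace l₁ l₂),
      (w, u) ≠ (0, 0) →
      w ∈ contingentCone P pbar →
      fderiv ℝ g (pbar, xbar) (w, u) ∈
        contingentCone (splitSet C₁ C₂) (g (pbar, xbar)) →
      lam ∈ directionalNormalCone (splitSet C₁ C₂) (g (pbar, xbar))
        (fderiv ℝ g (pbar, xbar) (w, u)) →
      ContinuousLinearMap.adjoint (fderiv ℝ (fun x => g (pbar, x)) xbar) lam = 0 →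
      lowerCurvature (splitSet C₁ C₂) lam (g (pbar, xbar))
          (fderiv ℝ g (pbar, xbar) (w, u)) ≤
        ((1 / 2 * fderiv ℝ (fderiv ℝ (fun z => inner ℝ lam (g z))) (pbar, xbar)
            (w, u) (w, u) : ℝ) : EReal) +
          upperCurvature P
            (ContinuousLinearMap.adjoint (fderiv ℝ (fun p => g (p, xbar)) pbar) lam) pbar w →
      lam.fst = 0) :
    RobinsonStable P g (splitSet C₁ C₂) pbar xbar := by 
  let e := WithLp.prodContinuousLinearEquiv 2 ℝ (EuclideanSpace ℝ (Fin l₁))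
    (EuclideanSpace ℝ (Fin l₂))
  -- The inner product of `WithLp 2` is by definition the sum of those of the components.
  have he : ∀ x y, inner ℝ x y = inner ℝ (e x).1 (e y).1 + inner ℝ (e x).2 (e y).2 :=
    fun x y => rfl
  have hset : splitSet C₁ C₂ = e ⁻¹' (C₁ ×ˢ C₂) := rfl
  have : ProperSpace (SplitSpace l₁ l₂) := FiniteDimensional.proper_real _
  rw [hset] at *
  exact robinsonStable_of_second_order he hfeas hC₁ hC₂ hsmooth hdiff htan hsub hsecond
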